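/- Let $\mathbb K$ be a field and let $n,k,m$ be integers with $n\ge 2$, $m\ge k\ge 3$ and $(n,k)\ne(2,3)$. Let $\mathbb K\langle X\rangle=\mathbb K\langle x_1,\dots,x_n\rangle$ be the free associative algebra, and let $\mathcal P_{n,k}^{(m)}$ be the finite-dimensional space of its cyclically invariant elements (the coefficient of $uv$ equals that of $vu$ for all words $u,v$) whose homogeneous components of degree $<k$ and of degree $>m$ vanish. Let $\delta_{x_j}$ be the linear map with $\delta_{x_j}(x_jv)=v$ for every word $v$ and $\delta_{x_j}(u)=0$ for every word $u$ not beginning with $x_j$. For $F\in\mathcal P_{n,k}^{(m)}$ let $I_F$ be the two-sided ideal of $\mathbb K\langle X\rangle$ generated by $\delta_{x_1}F,\dots,\delta_{x_n}F$, let $J^N$ be the two-sided ideal generated by all words of length $>N$, and let $$\bar A_F=\mathbb K\langle X\rangle\Big/\bigcap_{N\ge 0}(I_F+J^N)$$ be the completed potential algebra. Say that a property holds for generic $F\in\mathcal P_{n,k}^{(m)}$ if it holds for all $F$ outside some countable union of proper Zariski closed subsets of $\mathcal P_{n,k}^{(m)}$. Then for generic $F\in\mathcal P_{n,k}^{(m)}$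 one has $x_1a\ne 0$ in $\bar A_F$ for every non-zero $a\in\bar A_F$. The same holds, for generic $F$, when $\bar A_F$ is replaced by the quotient of the algebra of formal power series $\mathbb K\langle\langle x_1,\dots,x_n\rangle\rangle$ by the closure $\bigcap_N(\hat I_F+\hat J^N)$ of the two-sided ideal $\hat I_F$ which $\delta_{x_1}F,\dots,\delta_{x_n}F$ generate there, where $\hat J^N$ is the ideal of the series that involve only words of length $>N$. -/

import Mathlib

/-! ### The free algebra -/

/-- The free associative algebra `K⟨x₁, …, xₙ⟩`: finite linear combinations of words in `n` letters. -/
abbrev FreeAlg (K : Type*) [Field K] (n : ℕ) : Type _ := MonoidAlgebra K (FreeMonoid (Fin n))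

namespace FreeAlg

variable {K : Type*} [Field K] {n : ℕ}

/-- The generator `x_j` of the free algebra. -/
noncomputable def X (K : Type*) [Field K] {n : ℕ} (j : Fin n) : FreeAlg K n :=
  MonoidAlgebra.single (FreeMonoid.of j) 1

/-- The map `δ_{x_j}`: the linear map sending a word `x_j v` to `v` and killing the words that do not
begin with `x_j`. Its value at `F` has as coefficient of `v` the coefficient of `x_j v` in `F`. -/
noncomputable def delta (j : Fin n) (F : FreeAlg K n) : FreeAlg K n :=
  MonoidAlgebra.ofCoeff
    (F.coeff.comapDomain (fun v => FreeMonoid.of j * v) (mul_right_injective _).injOn)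

/-- The two-sided ideal `J^N` generated by all words of length strictly bigger than `N`. -/
noncomputable def highDegree (K : Type*) [Field K] (n N : ℕ) : TwoSidedIdeal (FreeAlg K n) :=
  TwoSidedIdeal.span {f | ∃ w : FreeMonoid (Fin n), N < w.length ∧ f = MonoidAlgebra.single w 1}

end FreeAlg

/-! ### Potentials -/

/-- The space of potentials with components in degrees `k, …, m` only: the cyclically invariant
elements of `K⟨x₁, …, xₙ⟩` all of whose words have length between `k` and `m`. -/
def potentials (K : Type*) [Field K] (n k m : ℕ) : Submodule K (FreeAlg K n) where
  carrier := {F | (∀ u v : FreeMonoid (Fin n), F.coeff (u * v) = F.coeff (v * u)) ∧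
    ∀ w : FreeMonoid (Fin n), F.coeff w ≠ 0 → k ≤ w.length ∧ w.length ≤ m}
  zero_mem' := by simp
  add_mem' := by
    rintro F G ⟨hF, hF'⟩ ⟨hG, hG'⟩
    refine ⟨fun u v => by simp [hF u v, hG u v], fun w hw => ?_⟩
    by_cases h : F.coeff w = 0
    · exact hG' w (by simpa [h] using hw)
    · exact hF' w h
  smul_mem' := by
    rintro c F ⟨hF, hF'⟩
    refine ⟨fun u v => by simp [hF u v], fun w hw => hF' w ?_⟩
    intro h
    exact hw (by simp [h])

/-! ### The completed potential algebra as a quotient of the free algebra -/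

/-- The ideal `I` of `K⟨x₁, …, xₙ⟩` generated by `δ_{x_1} F, …, δ_{x_n} F`, so that
`A_F = K⟨x₁, …, xₙ⟩ / I`. -/
noncomputable def relIdeal {K : Type*} [Field K] {n : ℕ} (F : FreeAlg K n) :
    TwoSidedIdeal (FreeAlg K n) :=
  TwoSidedIdeal.span (Set.range fun j : Fin n => FreeAlg.delta j F)

/-- The completion `⋂_N (I + J^N)` of the ideal `I`. -/
noncomputable def completedIdeal {K : Type*} [Field K] {n : ℕ} (F : FreeAlg K n) :
    TwoSidedIdeal (FreeAlg K n) :=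
  ⨅ N : ℕ, relIdeal F ⊔ FreeAlg.highDegree K n N

/-- The completed potential algebra `K⟨x₁, …, xₙ⟩ / ⋂_N (I + J^N)`. -/
abbrev CompletedAlg {K : Type*} [Field K] {n : ℕ} (F : FreeAlg K n) : Type _ :=
  (completedIdeal F).ringCon.Quotient

/-- The class of `x_j` in the completed potential algebra. -/
noncomputable def CompletedAlg.X {K : Type*} [Field K] {n : ℕ} (F : FreeAlg K n) (j : Fin n) :
    CompletedAlg F :=
  (completedIdeal F).ringCon.mk' (FreeAlg.X K j)

/-! ### Noncommutative formal power series -/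

open Classical in
/-- The finitely many factorizations `w = u * v` of a word, as pairs `(u, v)`. -/
noncomputable def wordSplits {n : ℕ} (w : FreeMonoid (Fin n)) :
    Finset (FreeMonoid (Fin n) × FreeMonoid (Fin n)) :=
  (Finset.range (w.length + 1)).image fun i =>
    (FreeMonoid.ofList (w.toList.take i), FreeMonoid.ofList (w.toList.drop i))

theorem mem_wordSplits {n : ℕ} {w : FreeMonoid (Fin n)}
    {p : FreeMonoid (Fin n) × FreeMonoid (Fin n)} : p ∈ wordSplits w ↔ p.1 * p.2 = w := by
  obtain ⟨u, v⟩ := p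
  simp only [wordSplits, Finset.mem_image, Finset.mem_range, Prod.mk.injEq]
  constructor
  · rintro ⟨i, -, rfl, rfl⟩
    exact FreeMonoid.toList.injective (by simp [FreeMonoid.toList_mul])
  · rintro rfl
    refine ⟨u.length, ?_, ?_, ?_⟩
    · simp [FreeMonoid.length_mul]
    · apply FreeMonoid.toList.injective
      simp [FreeMonoid.toList_mul, FreeMonoid.length]
    · apply FreeMonoid.toList.injective
      simp [FreeMonoid.toList_mul, FreeMonoid.length]

/-- The formal power series `K⟨⟨x₁, …, xₙ⟩⟩` in noncommuting variables: arbitrary families of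
coefficients indexed by the words. -/
@[ext]
structure NCSeries (K : Type*) [Field K] (n : ℕ) where
  /-- The coefficient of a word. -/
  coeff : FreeMonoid (Fin n) → K

namespace NCSeries

variable {K : Type*} [Field K] {n : ℕ}

instance : Zero (NCSeries K n) := ⟨⟨0⟩⟩
instance : Add (NCSeries K n) := ⟨fun f g => ⟨f.coeff + g.coeff⟩⟩
instance : Neg (NCSeries K n) := ⟨fun f => ⟨-f.coeff⟩⟩
instance : One (NCSeries K n) := ⟨⟨fun w => if w.length = 0 then 1 else 0⟩⟩
noncomputable instance : Mul (NCSeries K n) :=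
  ⟨fun f g => ⟨fun w => ∑ p ∈ wordSplits w, f.coeff p.1 * g.coeff p.2⟩⟩

theorem coeff_zero (w : FreeMonoid (Fin n)) : (0 : NCSeries K n).coeff w = 0 := rfl
theorem coeff_add (f g : NCSeries K n) (w : FreeMonoid (Fin n)) :
    (f + g).coeff w = f.coeff w + g.coeff w := rfl
theorem coeff_neg (f : NCSeries K n) (w : FreeMonoid (Fin n)) :
    (-f).coeff w = -f.coeff w := rfl
theorem coeff_one (w : FreeMonoid (Fin n)) :
    (1 : NCSeries K n).coeff w = if w.length = 0 then 1 else 0 := rfl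
theorem coeff_mul (f g : NCSeries K n) (w : FreeMonoid (Fin n)) :
    (f * g).coeff w = ∑ p ∈ wordSplits w, f.coeff p.1 * g.coeff p.2 := rfl

protected theorem mul_assoc (f g h : NCSeries K n) : f * g * h = f * (g * h) := by
  ext w
  simp only [coeff_mul, Finset.sum_mul, Finset.mul_sum, Finset.sum_sigma']
  apply Finset.sum_nbij' (fun ⟨⟨_i, j⟩, ⟨k, l⟩⟩ ↦ ⟨(k, l * j), (l, j)⟩)
    (fun ⟨⟨i, _j⟩, ⟨k, l⟩⟩ ↦ ⟨(i * k, l), (i, k)⟩)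
  · rintro ⟨⟨i, j⟩, ⟨k, l⟩⟩ hp
    simp only [Finset.mem_sigma, mem_wordSplits] at hp ⊢
    simp [← hp.1, ← hp.2, mul_assoc]
  · rintro ⟨⟨i, j⟩, ⟨k, l⟩⟩ hp
    simp only [Finset.mem_sigma, mem_wordSplits] at hp ⊢
    simp [← hp.1, ← hp.2, mul_assoc]
  · rintro ⟨⟨i, j⟩, ⟨k, l⟩⟩ hp
    simp only [Finset.mem_sigma, mem_wordSplits] at hp
    simp [← hp.2]
  · rintro ⟨⟨i, j⟩, ⟨k, l⟩⟩ hp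
    simp only [Finset.mem_sigma, mem_wordSplits] at hp
    simp [← hp.2]
  · rintro ⟨⟨i, j⟩, ⟨k, l⟩⟩ hp
    simp [mul_assoc]

protected theorem one_mul (f : NCSeries K n) : 1 * f = f := by
  ext w
  rw [coeff_mul, Finset.sum_eq_single (1, w)]
  · simp [coeff_one]
  · rintro ⟨u, v⟩ huv hne
    simp only [mem_wordSplits] at huv
    have hu : u ≠ 1 := by
      rintro rfl
      exact hne (by simp [← huv])
    simp [coeff_one, FreeMonoid.length_eq_zero, hu]
  · simp [mem_wordSplits]

protected theorem mul_one (f : NCSeries K n) : f * 1 = f := by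
  ext w
  rw [coeff_mul, Finset.sum_eq_single (w, 1)]
  · simp [coeff_one]
  · rintro ⟨u, v⟩ huv hne
    simp only [mem_wordSplits] at huv
    have hv : v ≠ 1 := by
      rintro rfl
      exact hne (by simp [← huv])
    simp [coeff_one, FreeMonoid.length_eq_zero, hv]
  · simp [mem_wordSplits]

noncomputable instance : Ring (NCSeries K n) where
  add_assoc f g h := by ext w; simp [coeff_add, add_assoc]
  zero_add f := by ext w; simp [coeff_add, coeff_zero]
  add_zero f := by ext w; simp [coeff_add, coeff_zero]
  add_comm f g := by ext w; simp [coeff_add, add_comm]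
  neg_add_cancel f := by ext w; simp [coeff_add, coeff_neg, coeff_zero]
  nsmul := nsmulRec
  zsmul := zsmulRec
  left_distrib f g h := by
    ext w; simp [coeff_add, coeff_mul, mul_add, Finset.sum_add_distrib]
  right_distrib f g h := by
    ext w; simp [coeff_add, coeff_mul, add_mul, Finset.sum_add_distrib]
  zero_mul f := by ext w; simp [coeff_mul, coeff_zero]
  mul_zero f := by ext w; simp [coeff_mul, coeff_zero]
  mul_assoc := NCSeries.mul_assoc
  one_mul := NCSeries.one_mul
  mul_one := NCSeries.mul_one

/-- A noncommutative polynomial regarded as a formal power series. -/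
def ofFreeAlg (f : FreeAlg K n) : NCSeries K n := ⟨fun w => f.coeff w⟩

/-- The two-sided ideal of the series in which only words of length strictly bigger than `N`
occur. These ideals are a basis of neighbourhoods of `0` in the usual topology of the algebra of
formal power series. -/
noncomputable def highDegree (K : Type*) [Field K] (n N : ℕ) : TwoSidedIdeal (NCSeries K n) :=
  TwoSidedIdeal.span {f | ∀ w : FreeMonoid (Fin n), w.length ≤ N → f.coeff w = 0}

/-- The closed two-sided ideal of `K⟨⟨x₁, …, xₙ⟩⟩` generated by `δ_{x_1} F, …, δ_{x_n} F`: the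
closure `⋂_N (Î + J^N)` of the two-sided ideal `Î` generated by these elements. -/
noncomputable def closedRelIdeal (F : FreeAlg K n) : TwoSidedIdeal (NCSeries K n) :=
  ⨅ N : ℕ, TwoSidedIdeal.span (Set.range fun j : Fin n => ofFreeAlg (FreeAlg.delta j F)) ⊔
    highDegree K n N

end NCSeries

/-- The completed potential algebra as a quotient of the algebra of formal power series by the
closed ideal generated by the relations. -/
abbrev CompletedSeriesAlg {K : Type*} [Field K] {n : ℕ} (F : FreeAlg K n) : Type _ :=
  (NCSeries.closedRelIdeal F).ringCon.Quotient

/-- The class of `x_j` in the quotient of the algebra of formal power series. -/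
noncomputable def CompletedSeriesAlg.X {K : Type*} [Field K] {n : ℕ} (F : FreeAlg K n) (j : Fin n) :
    CompletedSeriesAlg F :=
  (NCSeries.closedRelIdeal F).ringCon.mk' (NCSeries.ofFreeAlg (FreeAlg.X K j))

/-! ### Generic points -/

/-- A Zariski closed subset of a vector space `V` (used for finite-dimensional `V`): the common
zero set of a set of polynomials in the linear functionals on `V`. -/
def IsZariskiClosed (K : Type*) [Field K] {V : Type*} [AddCommGroup V] [Module K V]
    (Z : Set V) : Prop :=
  ∃ S : Set (MvPolynomial (Module.Dual K V) K),
    Z = {v | ∀ p ∈ S, MvPolynomial.eval (fun φ : Module.Dual K V => φ v) p = 0}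

/-- `P` holds for generic `v ∈ V`: it holds outside a countable union of proper Zariski closed
subsets of `V`. -/
def HoldsGenerically (K : Type*) [Field K] {V : Type*} [AddCommGroup V] [Module K V]
    (P : V → Prop) : Prop :=
  ∃ Z : ℕ → Set V, (∀ i, IsZariskiClosed K (Z i) ∧ Z i ≠ Set.univ) ∧
    ∀ v, (∀ i, v ∉ Z i) → P v

/-!
Write `E` for the free algebra and, for a potential `F`, let `b_M(F)` be the dimension of
`E / (I_F + (words of length ≥ M))` (`FreeAlg.truncDim`). It suffices that for generic `F` and all
`M` left multiplication by `x₁` maps the `M`-th of these quotients injectively into the next one.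

*A recursive inequality.* As `F = ∑ (δ_j F) x_j` by cyclic invariance, the maps
`a ↦ (x_j a)_j` and `(a_j)_j ↦ (∑_j (δ_i δ_j F) a_j)_i` compose to zero modulo `I_F`. The cokernel of
the second one is the quotient algebra without its constants, so if `x₁` is injective in the relevant
degree, then `b_M ≥ 1 + n b_{M-1} - n b_{M-k+1} + b_{M-k}` (`FreeAlg.truncDim_recursion`).

*A special potential.* Let `G` be the sum of all rotations of the words `x^{k-2} i σ(i)`, where `x` is
one letter, `i` runs over the others and `σ` is an involution of them. The lexicographically leading
words of the `δ_j G` do not begin with `x₁` and overlap in a single way. Hence the number `d_M` of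
words of length `< M` which avoid them satisfies the opposite inequality
(`HasSingleOverlap.card_normalWords_le`). These normal words span the quotients for `G`, so
`b_M(G) ≤ d_M`, and the cokernel of `x₁` has dimension at most `d_{M+1} - d_M`. That the overlap
resolves, that is `b_M(G) = d_M`, need not be checked: it comes out of the argument.

*Comparison.* The dimensions `b_M(F)` and those of the cokernels of `x₁` are upper semicontinuous in
`F` (`exists_mvPolynomial_finrank_quotient_le`), so generically they are at most those of `G`. By
induction on `M`, every `F` has `b_M(F) ≥ d_M` (`FreeAlg.ncard_normalWords_le_truncDim`): a generic `F'`
with `b_M(F') ≤ b_M(F)` has injective `x₁` in lower degrees, by the dimension count, so the two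
inequalities can be compared. For generic `F` all dimensions are thus known, and the same dimension
count gives injectivity of `x₁` in every degree.

Generic positions with respect to several conditions exist only over an infinite field. Over a finite
field every set of potentials is Zariski closed, and the genericity statement holds trivially.
-/

/-! ### Words and degrees in the free algebra -/

namespace FreeAlg

variable {K : Type*} [Field K] {n : ℕ}

/-- The monomial of a word in the free algebra. -/
noncomputable abbrev mon (K : Type*) [Field K] {n : ℕ} (w : FreeMonoid (Fin n)) : FreeAlg K n :=
  MonoidAlgebra.single w 1

/-- The map `δ_{x_j}` as a linear map. -/
noncomputable def deltaL (j : Fin n) : FreeAlg K n →ₗ[K] FreeAlg K n where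
  toFun := delta j
  map_add' f g := by
    apply MonoidAlgebra.coeff_injective; ext w; simp [delta]
  map_smul' c f := by
    apply MonoidAlgebra.coeff_injective; ext w; simp [delta]

/-- The constant term as a linear functional. -/
def constL (K : Type*) [Field K] (n : ℕ) : FreeAlg K n →ₗ[K] K where
  toFun f := f.coeff 1
  map_add' _ _ := rfl
  map_smul' _ _ := rfl

theorem constL_apply (f : FreeAlg K n) : constL K n f = f.coeff 1 := rfl

theorem coeff_deltaL (j : Fin n) (f : FreeAlg K n) (w : FreeMonoid (Fin n)) :
    (deltaL j f).coeff w = f.coeff (FreeMonoid.of j * w) := rfl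

theorem linearMap_ext {V : Type*} [AddCommGroup V] [Module K V] {f g : FreeAlg K n →ₗ[K] V}
    (h : ∀ w, f (mon K w) = g (mon K w)) : f = g := by
  apply MonoidAlgebra.lhom_ext'
  intro w
  ext
  simpa using h w

theorem coeff_X_mul_of_mul (i j : Fin n) (f : FreeAlg K n) (w : FreeMonoid (Fin n)) :
    (X K i * f).coeff (FreeMonoid.of j * w) = if i = j then f.coeff w else 0 := by
  split_ifs with h
  · subst h
    have := MonoidAlgebra.coeff_single_mul_eq_mul_coeff (x := f) (r := (1 : K))
      (m := FreeMonoid.of i) (m₁ := FreeMonoid.of i * w) w (fun m' _ => by simp)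
    rw [X, this, one_mul]
  · apply MonoidAlgebra.coeff_single_mul_of_forall_mul_ne
    intro d hd
    have := congrArg FreeMonoid.toList hd
    simp [FreeMonoid.toList_mul] at this
    exact h this.1

theorem coeff_X_mul_one (i : Fin n) (f : FreeAlg K n) : (X K i * f).coeff 1 = 0 := by
  apply MonoidAlgebra.coeff_single_mul_of_forall_mul_ne
  intro d hd
  have := congrArg FreeMonoid.toList hd
  simp [FreeMonoid.toList_mul] at this

theorem deltaL_X_mul (i j : Fin n) (f : FreeAlg K n) :
    deltaL j (X K i * f) = if i = j then f else 0 := by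
  apply MonoidAlgebra.coeff_injective; ext w
  rw [coeff_deltaL, coeff_X_mul_of_mul]
  split_ifs <;> simp

theorem mon_mul (u v : FreeMonoid (Fin n)) : mon K (u * v) = mon K u * mon K v := by
  simp [mon, MonoidAlgebra.single_mul_single]

theorem mon_of (j : Fin n) : mon K (FreeMonoid.of j) = X K j := rfl

theorem mon_one : mon K (1 : FreeMonoid (Fin n)) = 1 := rfl

theorem deltaL_mon_one (j : Fin n) : deltaL j (mon K (1 : FreeMonoid (Fin n))) = 0 := by
  apply MonoidAlgebra.coeff_injective; ext w
  rw [coeff_deltaL]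
  apply Finsupp.single_eq_of_ne
  intro h
  have := congrArg FreeMonoid.toList h
  simp [FreeMonoid.toList_mul] at this

/-- Every element of the free algebra is `f(1) + ∑ x_j δ_j f`. -/
theorem eq_const_add_sum_X_mul_deltaL (f : FreeAlg K n) :
    f = f.coeff 1 • (1 : FreeAlg K n) + ∑ j, X K j * deltaL j f := by
  let L : FreeAlg K n →ₗ[K] FreeAlg K n := (constL K n).smulRight (1 : FreeAlg K n) +
    ∑ j, (LinearMap.mulLeft K (X K j)).comp (deltaL j)
  have h : LinearMap.id = L := by
    apply linearMap_ext
    intro w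
    induction w using FreeMonoid.casesOn with
    | one =>
      have h2 : (1 : FreeAlg K n).coeff 1 = 1 := MonoidAlgebra.coeff_one_one
      have h3 : ∀ j, deltaL j (1 : FreeAlg K n) = 0 := deltaL_mon_one
      rw [mon_one]
      simp [L, constL_apply, h2, h3]
    | of_mul j w =>
      have h1 := coeff_X_mul_one j (mon K w)
      simp [L, mon_mul, mon_of, deltaL_X_mul, constL_apply, h1]
  have := LinearMap.congr_fun h f
  simpa [L, constL_apply] using this

theorem deltaL_mul (j : Fin n) (f g : FreeAlg K n) (hf : f.coeff 1 = 0) :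
    deltaL j (f * g) = deltaL j f * g := by
  conv_lhs => rw [eq_const_add_sum_X_mul_deltaL f, hf]
  simp [Finset.sum_mul, mul_assoc, deltaL_X_mul]

theorem coeff_eq_zero_of_mul {f : FreeAlg K n} (g : FreeAlg K n) (hf : f.coeff 1 = 0) :
    (f * g).coeff 1 = 0 := by
  rw [eq_const_add_sum_X_mul_deltaL f, hf, zero_smul, zero_add, Finset.sum_mul,
    MonoidAlgebra.coeff_sum, Finsupp.finsetSum_apply]
  exact Finset.sum_eq_zero fun j _ => by rw [mul_assoc, coeff_X_mul_one]

/-- The elements of the free algebra in which only words of length at least `d` occur. -/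
noncomputable def order (K : Type*) [Field K] (n d : ℕ) : Submodule K (FreeAlg K n) :=
  MonoidAlgebra.supported K K {w | d ≤ w.length}

theorem mem_order {d : ℕ} {f : FreeAlg K n} :
    f ∈ order K n d ↔ ∀ w, w.length < d → f.coeff w = 0 := by
  simp [order, MonoidAlgebra.mem_supported']

theorem order_eq_span (d : ℕ) :
    order K n d = Submodule.span K (mon K '' {w : FreeMonoid (Fin n) | d ≤ w.length}) :=
  MonoidAlgebra.supported_eq_span_single _ _

theorem mon_mem_order {d : ℕ} {w : FreeMonoid (Fin n)} (h : d ≤ w.length) :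
    mon K w ∈ order K n d := by
  rw [order_eq_span]; exact Submodule.subset_span ⟨w, h, rfl⟩

theorem order_anti {d e : ℕ} (h : d ≤ e) : order K n e ≤ order K n d :=
  MonoidAlgebra.supported_mono fun _ hw => h.trans hw

theorem mul_mem_order {d e : ℕ} {f g : FreeAlg K n} (hf : f ∈ order K n d)
    (hg : g ∈ order K n e) : f * g ∈ order K n (d + e) := by
  rw [order_eq_span] at hf hg
  have := Submodule.mul_mem_mul hf hg
  rw [Submodule.span_mul_span] at this
  refine Submodule.span_le.2 ?_ this
  rintro _ ⟨_, ⟨u, hu, rfl⟩, _, ⟨v, hv, rfl⟩, rfl⟩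
  simp only [← mon_mul]
  apply mon_mem_order
  rw [FreeMonoid.length_mul]
  exact add_le_add hu hv

theorem deltaL_mem_order {d : ℕ} {f : FreeAlg K n} (hf : f ∈ order K n (d + 1)) (j : Fin n) :
    deltaL j f ∈ order K n d := by
  rw [mem_order] at hf ⊢
  intro w hw
  rw [coeff_deltaL]
  apply hf
  rw [FreeMonoid.length_mul, FreeMonoid.length_of]
  omega

/-- The two-sided ideal generated by the `δ_j F` and all words of length at least `M`, as a linear
subspace with generators depending linearly on `F`. -/
noncomputable def truncIdeal (F : FreeAlg K n) (M : ℕ) : Submodule K (FreeAlg K n) :=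
  order K n M ⊔ Submodule.span K (Set.range
    fun t : FreeMonoid (Fin n) × Fin n × FreeMonoid (Fin n) =>
      mon K t.1 * deltaL t.2.1 F * mon K t.2.2)

theorem order_le_truncIdeal (F : FreeAlg K n) (M : ℕ) : order K n M ≤ truncIdeal F M := le_sup_left

theorem gen_mem_truncIdeal (F : FreeAlg K n) (M : ℕ) (u : FreeMonoid (Fin n)) (j : Fin n)
    (v : FreeMonoid (Fin n)) : mon K u * deltaL j F * mon K v ∈ truncIdeal F M :=
  Submodule.mem_sup_right (Submodule.subset_span ⟨(u, j, v), rfl⟩)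

theorem truncIdeal_le {F : FreeAlg K n} {M : ℕ} {W : Submodule K (FreeAlg K n)}
    (h₁ : ∀ w : FreeMonoid (Fin n), M ≤ w.length → mon K w ∈ W)
    (h₂ : ∀ u j v, mon K u * deltaL j F * mon K v ∈ W) : truncIdeal F M ≤ W := by
  refine sup_le ?_ (Submodule.span_le.2 ?_)
  · rw [order_eq_span, Submodule.span_le]
    rintro _ ⟨w, hw, rfl⟩
    exact h₁ w hw
  · rintro _ ⟨⟨u, j, v⟩, rfl⟩
    exact h₂ u j v

theorem mem_of_forall_mon_mul {W W' : Submodule K (FreeAlg K n)}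
    (h : ∀ u, ∀ f ∈ W, mon K u * f ∈ W') (g f : FreeAlg K n) (hf : f ∈ W) : g * f ∈ W' := by
  induction g using MonoidAlgebra.induction_linear with
  | zero => simp
  | add a b ha hb => rw [add_mul]; exact add_mem ha hb
  | single w c =>
    have : MonoidAlgebra.single w c = c • mon K w := by simp [mon]
    rw [this, smul_mul_assoc]
    exact W'.smul_mem _ (h w f hf)

theorem mem_of_forall_mul_mon {W W' : Submodule K (FreeAlg K n)}
    (h : ∀ u, ∀ f ∈ W, f * mon K u ∈ W') (g f : FreeAlg K n) (hf : f ∈ W) : f * g ∈ W' := by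
  induction g using MonoidAlgebra.induction_linear with
  | zero => simp
  | add a b ha hb => rw [mul_add]; exact add_mem ha hb
  | single w c =>
    have : MonoidAlgebra.single w c = c • mon K w := by simp [mon]
    rw [this, mul_smul_comm]
    exact W'.smul_mem _ (h w f hf)

theorem mul_mem_truncIdeal_left_of_length {F : FreeAlg K n} {M : ℕ} {f : FreeAlg K n}
    (hf : f ∈ truncIdeal F M) (u : FreeMonoid (Fin n)) :
    mon K u * f ∈ truncIdeal F (M + u.length) := by
  suffices h : truncIdeal F M ≤ (truncIdeal F (M + u.length)).comap
      (LinearMap.mulLeft K (mon K u)) by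
    exact h hf
  apply truncIdeal_le
  · intro w hw
    simp only [Submodule.mem_comap, LinearMap.mulLeft_apply, ← mon_mul]
    apply order_le_truncIdeal
    apply mon_mem_order
    rw [FreeMonoid.length_mul]; omega
  · intro w j v
    simp only [Submodule.mem_comap, LinearMap.mulLeft_apply, ← mul_assoc, ← mon_mul]
    exact gen_mem_truncIdeal F _ _ _ _

theorem truncIdeal_anti (F : FreeAlg K n) {M N : ℕ} (h : M ≤ N) :
    truncIdeal F N ≤ truncIdeal F M := sup_le_sup_right (order_anti h) _

theorem mul_mem_truncIdeal_left {F : FreeAlg K n} {M : ℕ} (g : FreeAlg K n) {f : FreeAlg K n}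
    (hf : f ∈ truncIdeal F M) : g * f ∈ truncIdeal F M :=
  mem_of_forall_mon_mul (fun u _ hf => truncIdeal_anti F (Nat.le_add_right _ _)
    (mul_mem_truncIdeal_left_of_length hf u)) g f hf

theorem mul_mem_truncIdeal_right {F : FreeAlg K n} {M : ℕ} (g : FreeAlg K n) {f : FreeAlg K n}
    (hf : f ∈ truncIdeal F M) : f * g ∈ truncIdeal F M := by
  refine mem_of_forall_mul_mon (fun u f hf => ?_) g f hf
  suffices h : truncIdeal F M ≤ (truncIdeal F M).comap (LinearMap.mulRight K (mon K u)) by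
    exact h hf
  apply truncIdeal_le
  · intro w hw
    simp only [Submodule.mem_comap, LinearMap.mulRight_apply, ← mon_mul]
    apply order_le_truncIdeal
    apply mon_mem_order
    rw [FreeMonoid.length_mul]; omega
  · intro w j v
    simp only [Submodule.mem_comap, LinearMap.mulRight_apply, mul_assoc, ← mon_mul]
    rw [← mul_assoc]
    exact gen_mem_truncIdeal F _ _ _ _

theorem X_mul_mem_truncIdeal {F : FreeAlg K n} {M : ℕ} (j : Fin n) {f : FreeAlg K n}
    (hf : f ∈ truncIdeal F M) : X K j * f ∈ truncIdeal F (M + 1) := by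
  simpa [mon_of] using mul_mem_truncIdeal_left_of_length hf (FreeMonoid.of j)

theorem order_mul_mem_truncIdeal {F : FreeAlg K n} {d M : ℕ} {f g : FreeAlg K n}
    (hg : g ∈ order K n d) (hf : f ∈ truncIdeal F M) : g * f ∈ truncIdeal F (M + d) := by
  suffices h : order K n d ≤ (truncIdeal F (M + d)).comap (LinearMap.mulRight K f) by
    exact h hg
  rw [order_eq_span, Submodule.span_le]
  rintro _ ⟨w, hw, rfl⟩
  exact truncIdeal_anti F (Nat.add_le_add_left hw _) (mul_mem_truncIdeal_left_of_length hf w)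

/-- If a set of finitely many words spans modulo `W`, it bounds the codimension of `W`. -/
theorem finrank_quotient_le_of_forall_mon_mem {W : Submodule K (FreeAlg K n)}
    (T : Finset (FreeMonoid (Fin n)))
    (h : ∀ w, mon K w ∈ Submodule.span K (mon K '' T) ⊔ W) :
    Module.Finite K (FreeAlg K n ⧸ W) ∧ Module.finrank K (FreeAlg K n ⧸ W) ≤ T.card := by
  classical
  have htop : Submodule.span K
      ((T.image fun w => W.mkQ (mon K w) :) : Set (FreeAlg K n ⧸ W)) = ⊤ := by
    rw [Finset.coe_image, ← Function.comp_def, Set.image_comp, Submodule.span_image]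
    have h2 : (⊤ : Submodule K (FreeAlg K n)) ≤ Submodule.span K (mon K '' T) ⊔ W := by
      intro f _
      induction f using MonoidAlgebra.induction_linear with
      | zero => simp
      | add a b ha hb => exact add_mem (ha trivial) (hb trivial)
      | single w c =>
        have : MonoidAlgebra.single w c = c • mon K w := by simp [mon]
        rw [this]
        exact Submodule.smul_mem _ _ (h w)
    have h3 := Submodule.map_mono (f := W.mkQ) h2
    rw [Submodule.map_top, Submodule.range_mkQ, Submodule.map_sup, Submodule.mkQ_map_self,
      sup_bot_eq] at h3
    exact top_le_iff.1 h3
  refine ⟨⟨⟨_, htop⟩⟩, ?_⟩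
  have := finrank_span_finset_le_card (R := K) (T.image fun w => W.mkQ (mon K w))
  rw [Set.finrank, htop, finrank_top] at this
  exact this.trans Finset.card_image_le

theorem finite_words_lt (n M : ℕ) : {w : FreeMonoid (Fin n) | w.length < M}.Finite :=
  List.finite_length_lt (Fin n) M

theorem finite_quotient_order (M : ℕ) : Module.Finite K (FreeAlg K n ⧸ order K n M) := by
  refine (finrank_quotient_le_of_forall_mon_mem (finite_words_lt n M).toFinset fun w => ?_).1
  by_cases hw : w.length < M
  · exact Submodule.mem_sup_left (Submodule.subset_span ⟨w, by simpa using hw, rfl⟩)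
  · exact Submodule.mem_sup_right (mon_mem_order (not_lt.1 hw))

theorem finite_quotient_of_order_le {M : ℕ} {W : Submodule K (FreeAlg K n)}
    (h : order K n M ≤ W) : Module.Finite K (FreeAlg K n ⧸ W) := by
  have := finite_quotient_order (K := K) (n := n) M
  exact Module.Finite.of_surjective (Submodule.factor h) (Submodule.factor_surjective h)

instance (F : FreeAlg K n) (M : ℕ) : Module.Finite K (FreeAlg K n ⧸ truncIdeal F M) :=
  finite_quotient_of_order_le (order_le_truncIdeal F M)


/-! ### The recursive inequality for the dimensions of the truncations -/

/-- For cyclically invariant `F` without constant term, `∑ δ_j F x_j = F`. -/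
theorem sum_deltaL_mul_X {F : FreeAlg K n}
    (hcyc : ∀ u v : FreeMonoid (Fin n), F.coeff (u * v) = F.coeff (v * u))
    (h1 : F.coeff 1 = 0) : ∑ j, deltaL j F * X K j = F := by
  apply MonoidAlgebra.coeff_injective
  ext w
  rw [MonoidAlgebra.coeff_sum, Finsupp.finsetSum_apply]
  rcases List.eq_nil_or_concat' w.toList with h | ⟨v, i, h⟩
  · obtain rfl : w = 1 := h
    rw [h1]
    refine Finset.sum_eq_zero fun j _ => ?_
    apply MonoidAlgebra.coeff_mul_single_of_forall_mul_ne
    intro d hd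
    have := congrArg FreeMonoid.toList hd
    simp [FreeMonoid.toList_mul] at this
  · obtain rfl : w = FreeMonoid.ofList v * FreeMonoid.of i := h
    rw [Finset.sum_eq_single i]
    · have := MonoidAlgebra.coeff_mul_single_eq_coeff_mul (x := deltaL i F) (r := (1 : K))
        (m := FreeMonoid.of i) (m₁ := FreeMonoid.ofList v * FreeMonoid.of i)
        (FreeMonoid.ofList v) (fun m' _ => by simp)
      rw [X, this, mul_one, coeff_deltaL, hcyc]
    · intro j _ hj
      apply MonoidAlgebra.coeff_mul_single_of_forall_mul_ne
      intro d hd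
      have := congrArg FreeMonoid.toList hd
      simp [FreeMonoid.toList_mul] at this
      exact hj this.2
    · simp

/-- The codimension of `truncIdeal F M`. -/
noncomputable def truncDim (F : FreeAlg K n) (M : ℕ) : ℕ :=
  Module.finrank K (FreeAlg K n ⧸ truncIdeal F M)

/-- The maps `f ↦ (x_j f)_j` and `(f_j)_j ↦ (∑_j (δ_i δ_j F) f_j)_i` compose to zero, and the
cokernel of the second one is the truncated algebra without its constants. -/
theorem truncDim_recursion {F : FreeAlg K n} {d m : ℕ} (i₀ : Fin n)
    (hcyc : ∀ u v : FreeMonoid (Fin n), F.coeff (u * v) = F.coeff (v * u))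
    (hord : F ∈ order K n (d + 2))
    (hinj : ∀ f, X K i₀ * f ∈ truncIdeal F (m + 1) → f ∈ truncIdeal F m) :
    1 + n * truncDim F (m + d + 1) + truncDim F m ≤
      truncDim F (m + d + 2) + n * truncDim F (m + 1) := by
  have hF1 : F.coeff 1 = 0 := mem_order.1 hord 1 (by simp)
  have hd1 : ∀ j, deltaL j F ∈ order K n (d + 1) := deltaL_mem_order hord
  have hd2 : ∀ i j, deltaL i (deltaL j F) ∈ order K n d := fun i j => deltaL_mem_order (hd1 j) i
  have hd0 : ∀ j, (deltaL j F).coeff 1 = 0 := fun j => mem_order.1 (hd1 j) 1 (by simp)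
  have hmul : ∀ i j, truncIdeal F (m + 1) ≤
      (truncIdeal F (m + d + 1)).comap (LinearMap.mulLeft K (deltaL i (deltaL j F))) := by
    intro i j f hf
    have := order_mul_mem_truncIdeal (hd2 i j) hf
    rwa [show m + 1 + d = m + d + 1 by ring] at this
  have hX : ∀ j, truncIdeal F m ≤ (truncIdeal F (m + 1)).comap (LinearMap.mulLeft K (X K j)) :=
    fun j f hf => X_mul_mem_truncIdeal j hf
  let φ : (Fin n → FreeAlg K n ⧸ truncIdeal F (m + 1)) →ₗ[K]
      K × (Fin n → FreeAlg K n ⧸ truncIdeal F (m + d + 1)) :=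
    (LinearMap.inr K K _).comp (LinearMap.pi fun i => ∑ j,
      (Submodule.mapQ _ _ _ (hmul i j)).comp (LinearMap.proj j))
  let ψ : (FreeAlg K n ⧸ truncIdeal F m) →ₗ[K] (Fin n → FreeAlg K n ⧸ truncIdeal F (m + 1)) :=
    LinearMap.pi fun j => Submodule.mapQ _ _ _ (hX j)
  let Φ : FreeAlg K n →ₗ[K] K × (Fin n → FreeAlg K n ⧸ truncIdeal F (m + d + 1)) :=
    (constL K n).prod (LinearMap.pi fun i => (truncIdeal F (m + d + 1)).mkQ.comp (deltaL i))
  have hΦ1 : ∀ f, (Φ f).1 = f.coeff 1 := fun _ => rfl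
  have hΦ2 : ∀ f i, (Φ f).2 i = (truncIdeal F (m + d + 1)).mkQ (deltaL i f) := fun _ _ => rfl
  have hψinj : Function.Injective ψ := by
    rw [injective_iff_map_eq_zero]
    intro q hq
    obtain ⟨f, rfl⟩ := Submodule.mkQ_surjective _ q
    have := congrFun hq i₀
    simp only [ψ, LinearMap.pi_apply, Submodule.mkQ_apply, Submodule.mapQ_apply,
      LinearMap.mulLeft_apply, Pi.zero_apply, Submodule.Quotient.mk_eq_zero] at this
    simpa using hinj f this
  have hφψ : LinearMap.range ψ ≤ LinearMap.ker φ := by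
    rintro _ ⟨q, rfl⟩
    obtain ⟨f, rfl⟩ := Submodule.mkQ_surjective _ q
    have key : ∀ i, ∑ j, deltaL i (deltaL j F) * (X K j * f) = deltaL i F * f := by
      intro i
      have h := congrArg (deltaL i) (sum_deltaL_mul_X hcyc hF1)
      rw [map_sum] at h
      simp_rw [deltaL_mul i _ _ (hd0 _)] at h
      rw [← h, Finset.sum_mul]
      simp_rw [mul_assoc]
    simp only [φ, ψ, LinearMap.mem_ker, LinearMap.comp_apply, LinearMap.inr_apply, Prod.mk_eq_zero,
      true_and]
    ext i
    simp only [LinearMap.pi_apply, LinearMap.sum_apply, LinearMap.comp_apply, LinearMap.proj_apply,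
      Submodule.mkQ_apply, Submodule.mapQ_apply, LinearMap.mulLeft_apply, Pi.zero_apply]
    simp_rw [← Submodule.mkQ_apply]
    rw [← map_sum, key, Submodule.mkQ_apply, Submodule.Quotient.mk_eq_zero]
    apply mul_mem_truncIdeal_right
    have := gen_mem_truncIdeal F (m + d + 1) 1 i 1
    simpa [mon_one] using this
  have hΦsurj : Function.Surjective Φ := by
    rintro ⟨c, q⟩
    choose f hf using fun i => Submodule.mkQ_surjective _ (q i)
    refine ⟨c • 1 + ∑ j, X K j * f j, ?_⟩
    have h1 : ∀ i, deltaL i (1 : FreeAlg K n) = 0 := fun i => by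
      rw [← mon_one, deltaL_mon_one]
    have h2 : (1 : FreeAlg K n).coeff 1 = 1 := MonoidAlgebra.coeff_one_one
    ext i
    · rw [hΦ1, MonoidAlgebra.coeff_add, MonoidAlgebra.coeff_sum]
      simp [coeff_X_mul_one, h2]
    · rw [hΦ2, map_add, map_smul, h1, smul_zero, zero_add, map_sum]
      simp_rw [deltaL_X_mul]
      rw [Finset.sum_ite_eq' Finset.univ i f, if_pos (Finset.mem_univ i), hf]
  have hΦ : truncIdeal F (m + d + 2) ≤ LinearMap.ker ((LinearMap.range φ).mkQ.comp Φ) := by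
    apply truncIdeal_le
    · intro w hw
      induction w using FreeMonoid.casesOn with
      | one => simp at hw
      | of_mul j w =>
        have : Φ (mon K (FreeMonoid.of j * w)) = 0 := by
          have hw' : mon K w ∈ truncIdeal F (m + d + 1) := by
            apply order_le_truncIdeal
            apply mon_mem_order
            rw [FreeMonoid.length_mul, FreeMonoid.length_of] at hw
            omega
          ext i
          · simp [hΦ1, mon_mul, mon_of, coeff_X_mul_one]
          · rw [hΦ2, mon_mul, mon_of, deltaL_X_mul]
            split_ifs <;> simp [hw']
        rw [LinearMap.mem_ker, LinearMap.comp_apply, this, map_zero]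
    · intro u j v
      induction u using FreeMonoid.casesOn with
      | one =>
        rw [LinearMap.mem_ker, LinearMap.comp_apply, Submodule.mkQ_apply,
          Submodule.Quotient.mk_eq_zero, mon_one, one_mul]
        refine ⟨Pi.single j (Submodule.mkQ _ (mon K v)), ?_⟩
        ext i
        · have := coeff_eq_zero_of_mul (mon K v) (hd0 j)
          simp [φ, hΦ1, this]
        · simp only [hΦ2, φ, LinearMap.comp_apply, LinearMap.inr_apply, LinearMap.pi_apply,
            LinearMap.sum_apply, LinearMap.proj_apply]
          rw [Finset.sum_eq_single j]
          · simp [deltaL_mul i _ _ (hd0 j)]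
          · intro l _ hl
            simp [Pi.single_eq_of_ne hl]
          · simp
      | of_mul l u =>
        have : Φ (mon K (FreeMonoid.of l * u) * deltaL j F * mon K v) = 0 := by
          have hg := gen_mem_truncIdeal F (m + d + 1) u j v
          ext i
          · simp [hΦ1, mon_mul, mon_of, mul_assoc, coeff_X_mul_one]
          · rw [mul_assoc] at hg
            rw [hΦ2, mon_mul, mon_of, mul_assoc, mul_assoc, deltaL_X_mul]
            split_ifs <;> simp [hg]
        rw [LinearMap.mem_ker, LinearMap.comp_apply, this, map_zero]
  have e1 : Module.finrank K ((K × (Fin n → FreeAlg K n ⧸ truncIdeal F (m + d + 1))) ⧸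
      LinearMap.range φ) ≤ truncDim F (m + d + 2) := by
    refine LinearMap.finrank_le_finrank_of_surjective (f := Submodule.liftQ _ _ hΦ) ?_
    rw [← LinearMap.range_eq_top, Submodule.range_liftQ, LinearMap.range_eq_top]
    exact (Submodule.mkQ_surjective _).comp hΦsurj
  have e2 := Submodule.finrank_quotient_add_finrank (LinearMap.range φ)
  have e3 := LinearMap.finrank_range_add_finrank_ker φ
  have e4 := (LinearMap.finrank_range_of_inj hψinj).symm.trans_le (Submodule.finrank_mono hφψ)
  rw [Module.finrank_prod, Module.finrank_self, Module.finrank_pi_fintype] at e2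
  rw [Module.finrank_pi_fintype] at e3
  simp only [Finset.sum_const, Finset.card_univ, Fintype.card_fin, smul_eq_mul] at e2 e3
  unfold truncDim at *
  omega

end FreeAlg

/-! ### Semicontinuity -/

section Semicontinuity

variable {K : Type*} [Field K]

/-- The dimension of the quotient of `E` by a subspace whose generators depend linearly on a
parameter cannot jump up in a Zariski neighbourhood of any given parameter. -/
theorem exists_mvPolynomial_finrank_quotient_le {V E ι : Type*} [AddCommGroup V] [Module K V]
    [AddCommGroup E] [Module K E] (W : Submodule K E) [Module.Finite K (E ⧸ W)]
    (g : ι → V →ₗ[K] E) (v₀ : V) :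
    ∃ p : MvPolynomial (Module.Dual K V) K,
      MvPolynomial.eval (fun φ : Module.Dual K V => φ v₀) p ≠ 0 ∧
      ∀ v, MvPolynomial.eval (fun φ : Module.Dual K V => φ v) p ≠ 0 →
        Module.finrank K (E ⧸ (W ⊔ Submodule.span K (Set.range fun i => g i v))) ≤
        Module.finrank K (E ⧸ (W ⊔ Submodule.span K (Set.range fun i => g i v₀))) := by
  classical
  -- codimensions become dimensions of spans in the finite-dimensional space `E ⧸ W`
  let h : ι → V →ₗ[K] E ⧸ W := fun i => W.mkQ.comp (g i)
  have hdim : ∀ v, Module.finrank K (E ⧸ (W ⊔ Submodule.span K (Set.range fun i => g i v))) +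
      Module.finrank K (Submodule.span K (Set.range fun i => h i v)) =
        Module.finrank K (E ⧸ W) := by
    intro v
    rw [← Submodule.finrank_quotient_add_finrank (Submodule.span K (Set.range fun i => h i v))]
    congr 1
    have e1 : Submodule.span K (Set.range fun i => h i v) =
        (W ⊔ Submodule.span K (Set.range fun i => g i v)).map W.mkQ := by
      rw [Submodule.map_sup, Submodule.mkQ_map_self, bot_sup_eq, Submodule.map_span,
        ← Set.range_comp]
      rfl
    rw [e1]
    exact (Submodule.quotientQuotientEquivQuotient W _ le_sup_left).finrank_eq.symm
  obtain ⟨κ, a, _, hspan, hli⟩ := exists_linearIndependent' K (fun i => h i v₀)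
  have : Finite κ := hli.finite
  have : Fintype κ := Fintype.ofFinite κ
  obtain ⟨f, hf⟩ : ∃ f : κ → Module.Dual K (E ⧸ W),
      ∀ i j, f i (h (a j) v₀) = if i = j then 1 else 0 := by
    obtain ⟨l, hl⟩ := LinearMap.exists_leftInverse_of_injective
      (Finsupp.linearCombination K fun j => h (a j) v₀) (LinearMap.ker_eq_bot.2 hli)
    refine ⟨fun i => (Finsupp.lapply i).comp l, fun i j => ?_⟩
    have := LinearMap.congr_fun hl (Finsupp.single j 1)
    simp only [LinearMap.comp_apply, Finsupp.linearCombination_single, one_smul,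
      LinearMap.id_apply] at this
    simp [this, Finsupp.single_apply, eq_comm]
  -- a minor of size `rank` that is the identity matrix at `v₀`
  let A : Matrix κ κ (MvPolynomial (Module.Dual K V) K) :=
    fun i j => MvPolynomial.X ((f i).comp (h (a j)))
  have hA : ∀ v, MvPolynomial.eval (fun φ : Module.Dual K V => φ v) A.det =
      (Matrix.of fun i j => f i (h (a j) v)).det := by
    intro v
    rw [RingHom.map_det]
    congr 1
    ext i j
    rw [RingHom.mapMatrix_apply, Matrix.map_apply, MvPolynomial.eval_X]
    rfl
  refine ⟨A.det, ?_, fun v hv => ?_⟩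
  · rw [hA]
    have : (Matrix.of fun i j => f i (h (a j) v₀)) = 1 := by
      ext i j
      simp [hf, Matrix.one_apply]
    rw [this, Matrix.det_one]
    exact one_ne_zero
  · rw [hA] at hv
    have hliv : LinearIndependent K fun j => h (a j) v := by
      have h1 := Matrix.linearIndependent_cols_of_det_ne_zero hv
      refine LinearIndependent.of_comp (LinearMap.pi f) ?_
      exact h1
    have h1 := (finrank_span_eq_card hliv).symm.trans_le (Submodule.finrank_mono
      (Submodule.span_mono (Set.range_comp_subset_range a fun i => h i v)))
    have h2 := finrank_span_eq_card hli
    rw [hspan] at h2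
    have h3 := hdim v
    have h4 := hdim v₀
    omega

/-- Over an infinite field two non-empty Zariski open sets of the form `p ≠ 0` meet. -/
theorem exists_eval_mul_ne_zero [Infinite K] {V : Type*} [AddCommGroup V] [Module K V]
    {p q : MvPolynomial (Module.Dual K V) K} {v w : V}
    (hp : MvPolynomial.eval (fun φ : Module.Dual K V => φ v) p ≠ 0)
    (hq : MvPolynomial.eval (fun φ : Module.Dual K V => φ w) q ≠ 0) :
    ∃ u, MvPolynomial.eval (fun φ : Module.Dual K V => φ u) (p * q) ≠ 0 := by
  -- restrict both polynomials to the line through `v` and `w`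
  let L : MvPolynomial (Module.Dual K V) K →ₐ[K] Polynomial K :=
    MvPolynomial.aeval fun φ => Polynomial.C (φ v) + Polynomial.X * Polynomial.C (φ (w - v))
  have hL : ∀ (t : K) r, (L r).eval t =
      MvPolynomial.eval (fun φ : Module.Dual K V => φ (v + t • (w - v))) r := by
    intro t r
    have : (Polynomial.aeval t).comp L =
        MvPolynomial.aeval fun φ : Module.Dual K V => φ (v + t • (w - v)) := by
      ext φ
      simp [L]
    have := AlgHom.congr_fun this r
    simpa [MvPolynomial.aeval_eq_eval, Polynomial.coe_aeval_eq_eval] using this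
  have hLp : L p ≠ 0 := by
    intro h0
    apply hp
    have := hL 0 p
    simpa [h0] using this.symm
  have hLq : L q ≠ 0 := by
    intro h0
    apply hq
    have := hL 1 q
    simpa [h0] using this.symm
  obtain ⟨t, ht⟩ : ∃ t, (L p * L q).eval t ≠ 0 := by
    by_contra! hcon
    exact mul_ne_zero hLp hLq (Polynomial.funext fun t => by simpa using hcon t)
  refine ⟨v + t • (w - v), ?_⟩
  rw [← map_mul, hL] at ht
  exact ht

theorem isZariskiClosed_zeros {V : Type*} [AddCommGroup V] [Module K V]
    (p : MvPolynomial (Module.Dual K V) K) :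
    IsZariskiClosed K {v : V | MvPolynomial.eval (fun φ : Module.Dual K V => φ v) p = 0} :=
  ⟨{p}, by simp⟩

theorem isZariskiClosed_singleton {V : Type*} [AddCommGroup V] [Module K V] (v : V) :
    IsZariskiClosed K {v} := by
  refine ⟨Set.range fun φ : Module.Dual K V => MvPolynomial.X φ - MvPolynomial.C (φ v), ?_⟩
  ext w
  simp only [Set.mem_singleton_iff, Set.forall_mem_range, Set.mem_ofPred_eq, map_sub,
    MvPolynomial.eval_X, MvPolynomial.eval_C]
  constructor
  · rintro rfl; simp
  · intro h
    rw [← sub_eq_zero, ← Module.forall_dual_apply_eq_zero_iff K]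
    intro φ
    rw [map_sub, h φ]

end Semicontinuity

/-! ### Normal words -/

/-- A word is normal with respect to a family `u` of words if it contains none of them as a block of
consecutive letters. -/
def IsNormalWord {n : ℕ} (u : Fin n → List (Fin n)) (w : List (Fin n)) : Prop :=
  ∀ j, ¬ u j <:+: w

/-- The normal words of length less than `M`. -/
def normalWords {n : ℕ} (u : Fin n → List (Fin n)) (M : ℕ) : Set (List (Fin n)) :=
  {w | w.length < M ∧ IsNormalWord u w}

/-- A family of `n` words of length `d + 1`, none of them beginning with `x₀`, that overlap in a
single way: whenever a normal word `v` follows the tail of `u j` and an occurrence of some `u l`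
arises, `j = p` and `v` begins with `q`, where `p` and `q` do not depend on `j`, `v`. -/
structure HasSingleOverlap {n : ℕ} (d : ℕ) (x₀ : Fin n) (u : Fin n → List (Fin n)) : Prop where
  length_eq : ∀ j, (u j).length = d + 1
  injective : Function.Injective u
  head_ne : ∀ j t, u j ≠ x₀ :: t
  overlap : ∃ p q, ∀ j v, IsNormalWord u v → ¬ IsNormalWord u ((u j).tail ++ v) →
    j = p ∧ ∃ v', v = q :: v'

section NormalWords

variable {n : ℕ} {u : Fin n → List (Fin n)}

theorem IsNormalWord.of_infix {v w : List (Fin n)} (hw : IsNormalWord u w) (h : v <:+: w) :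
    IsNormalWord u v := fun j hj => hw j (hj.trans h)

theorem normalWords_finite (u : Fin n → List (Fin n)) (M : ℕ) : (normalWords u M).Finite :=
  (List.finite_length_lt (Fin n) M).subset fun _ h => h.1

/-- A word `c t` with `t` normal is normal or begins with a unique `u j`; in the second case it is
`u j v` with `v` normal, and the pairs `(j, v)` not arising in this way are accounted for by the
single overlap. -/
theorem HasSingleOverlap.card_normalWords_le {d : ℕ} {x₀ : Fin n} (h : HasSingleOverlap d x₀ u)
    (m : ℕ) :
    (normalWords u (m + d + 2)).ncard + n * (normalWords u (m + 1)).ncard ≤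
      1 + n * (normalWords u (m + d + 1)).ncard + (normalWords u m).ncard := by
  obtain ⟨p, q, hpq⟩ := h.overlap
  -- The normal words and the words of `S` lie among the empty word, the words `c t` with `t` normal
  -- (the set `C`), and the words of `S` whose tail is not normal, which lie in the set `D`.
  set S := (fun t : Fin n × List (Fin n) => u t.1 ++ t.2) '' (Set.univ ×ˢ normalWords u (m + 1))
    with hS
  have hScard : S.ncard = n * (normalWords u (m + 1)).ncard := by
    rw [hS, Set.ncard_image_of_injective, Set.ncard_prod, Set.ncard_univ, Nat.card_eq_fintype_card,
      Fintype.card_fin]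
    rintro ⟨i, v⟩ ⟨j, w⟩ hij
    obtain ⟨h1, h2⟩ := List.append_inj hij (by rw [h.length_eq, h.length_eq])
    simp only at h1 h2
    rw [h.injective h1, h2]
  have hSfin : S.Finite := (Set.finite_univ.prod (normalWords_finite u _)).image _
  have hdisj : Disjoint (normalWords u (m + d + 2)) S := by
    rw [Set.disjoint_left]
    rintro _ hw ⟨⟨j, v⟩, -, rfl⟩
    exact hw.2 j (List.prefix_append _ _).isInfix
  set C := (fun t : Fin n × List (Fin n) => t.1 :: t.2) '' (Set.univ ×ˢ normalWords u (m + d + 1))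
    with hC
  have hCcard : C.ncard ≤ n * (normalWords u (m + d + 1)).ncard := by
    refine (Set.ncard_image_le (Set.finite_univ.prod (normalWords_finite u _))).trans_eq ?_
    rw [Set.ncard_prod, Set.ncard_univ, Nat.card_eq_fintype_card, Fintype.card_fin]
  have hCfin : C.Finite := (Set.finite_univ.prod (normalWords_finite u _)).image _
  set D := (fun v : List (Fin n) => u p ++ q :: v) '' normalWords u m with hD
  have hDcard : D.ncard ≤ (normalWords u m).ncard := Set.ncard_image_le (normalWords_finite u _)
  have hDfin : D.Finite := (normalWords_finite u _).image _
  have hsub : normalWords u (m + d + 2) ∪ S ⊆ {[]} ∪ C ∪ D := by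
    rintro w (hw | ⟨⟨j, v⟩, ⟨-, hv⟩, rfl⟩)
    · rcases w with _ | ⟨c, t⟩
      · exact Or.inl (Or.inl rfl)
      · refine Or.inl (Or.inr ⟨(c, t), ⟨trivial, ?_, ?_⟩, rfl⟩)
        · have := hw.1
          simp only [List.length_cons] at this ⊢
          omega
        · exact hw.2.of_infix (List.suffix_cons c t).isInfix
    · simp only at hv ⊢
      obtain ⟨c, t, hct⟩ : ∃ c t, u j = c :: t := by
        apply List.exists_cons_of_length_pos
        rw [h.length_eq]; omega
      have ht : t.length = d := by
        have := h.length_eq j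
        rw [hct] at this
        simpa using this
      by_cases hn : IsNormalWord u ((u j).tail ++ v)
      · refine Or.inl (Or.inr ⟨(c, t ++ v), ⟨trivial, ?_, ?_⟩, ?_⟩)
        · have := hv.1
          simp only [List.length_append]
          omega
        · simpa [hct] using hn
        · simp [hct]
      · obtain ⟨rfl, v', rfl⟩ := hpq j v hv.2 hn
        refine Or.inr ⟨v', ⟨?_, ?_⟩, rfl⟩
        · have := hv.1
          simp only [List.length_cons] at this
          omega
        · exact hv.2.of_infix (List.suffix_cons q v').isInfix
  calc (normalWords u (m + d + 2)).ncard + n * (normalWords u (m + 1)).ncard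
      = (normalWords u (m + d + 2) ∪ S).ncard := by
        rw [Set.ncard_union_eq hdisj (normalWords_finite u _) hSfin, hScard]
    _ ≤ ({[]} ∪ C ∪ D).ncard :=
        Set.ncard_le_ncard hsub (((Set.finite_singleton _).union hCfin).union hDfin)
    _ ≤ ({[]} : Set (List (Fin n))).ncard + C.ncard + D.ncard :=
        (Set.ncard_union_le _ _).trans (Nat.add_le_add_right (Set.ncard_union_le _ _) _)
    _ ≤ _ := by
        rw [Set.ncard_singleton]
        omega

/-- Prefixing `x₀` keeps a word normal. -/
theorem HasSingleOverlap.ncard_add_ncard_le {d : ℕ} {x₀ : Fin n} (h : HasSingleOverlap d x₀ u)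
    (M : ℕ) :
    {w ∈ normalWords u (M + 1) | ∀ t, w ≠ x₀ :: t}.ncard + (normalWords u M).ncard ≤
      (normalWords u (M + 1)).ncard := by
  rw [← Set.ncard_image_of_injective (normalWords u M) (List.cons_injective (a := x₀)),
    ← Set.ncard_union_eq _ ((normalWords_finite u _).subset (Set.sep_subset _ _))
      ((normalWords_finite u _).image _)]
  · refine Set.ncard_le_ncard ?_ (normalWords_finite u _)
    rintro w (hw | ⟨v, hv, rfl⟩)
    · exact hw.1
    · refine ⟨by simpa using hv.1, fun j hj => ?_⟩
      rcases List.infix_cons_iff.1 hj with hp | hi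
      · rcases List.prefix_cons_iff.1 hp with h0 | ⟨t, ht, -⟩
        · have := h.length_eq j
          simp [h0] at this
        · exact h.head_ne j t ht
      · exact hv.2 j hi
  · rw [Set.disjoint_left]
    rintro _ hw ⟨v, -, rfl⟩
    exact hw.2 v rfl

/-- The number with a given string of base `n` digits. On words of equal length its order is the
lexicographic one. -/
def wordValue {n : ℕ} : List (Fin n) → ℕ
  | [] => 0
  | c :: t => c * n ^ t.length + wordValue t

theorem wordValue_append (v w : List (Fin n)) :
    wordValue (v ++ w) = wordValue v * n ^ w.length + wordValue w := by
  induction v with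
  | nil => simp [wordValue]
  | cons c t ih =>
    simp only [List.cons_append, wordValue, ih, List.length_append, pow_add]
    ring

theorem wordValue_lt (w : List (Fin n)) : wordValue w < n ^ w.length := by
  induction w with
  | nil => simp [wordValue]
  | cons c t ih =>
    simp only [wordValue, List.length_cons, pow_succ]
    have h1 : ((c : ℕ) + 1) * n ^ t.length ≤ n * n ^ t.length := Nat.mul_le_mul_right _ c.2
    nlinarith

theorem wordValue_cons_lt {a b : Fin n} (hab : a < b) {v w : List (Fin n)}
    (h : v.length = w.length) : wordValue (a :: v) < wordValue (b :: w) := by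
  simp only [wordValue, h]
  have h1 : ((a : ℕ) + 1) * n ^ w.length ≤ b * n ^ w.length := Nat.mul_le_mul_right _ hab
  have h2 := wordValue_lt v
  rw [h] at h2
  nlinarith

theorem wordValue_append_left_lt (a : List (Fin n)) {v w : List (Fin n)}
    (h : v.length = w.length) (hvw : wordValue v < wordValue w) :
    wordValue (a ++ v) < wordValue (a ++ w) := by
  rw [wordValue_append, wordValue_append, h]
  omega

theorem wordValue_append_right_lt [NeZero n] (b : List (Fin n)) {v w : List (Fin n)}
    (hvw : wordValue v < wordValue w) : wordValue (v ++ b) < wordValue (w ++ b) := by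
  rw [wordValue_append, wordValue_append]
  have := Nat.pow_pos (n := b.length) (NeZero.pos n)
  have := Nat.mul_lt_mul_of_pos_right hvw this
  omega

end NormalWords

namespace FreeAlg

variable {K : Type*} [Field K] {n : ℕ}

theorem finrank_quotient_le_ncard {W : Submodule K (FreeAlg K n)} {S : Set (List (Fin n))}
    (hS : S.Finite)
    (h : ∀ w, mon K w ∈ Submodule.span K (mon K '' (FreeMonoid.ofList '' S)) ⊔ W) :
    Module.finrank K (FreeAlg K n ⧸ W) ≤ S.ncard := by
  have hS' : (FreeMonoid.ofList '' S).Finite := hS.image _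
  rw [← Set.ncard_image_of_injective S FreeMonoid.ofList.injective,
    Set.ncard_eq_toFinset_card _ hS']
  exact (finrank_quotient_le_of_forall_mon_mem hS'.toFinset
    (by rwa [Set.Finite.coe_toFinset])).2

/-- The word `u j` occurs in `δ_j G` with coefficient `1`, and all the other words of `δ_j G` have
the same length and precede it. -/
structure HasLeadingWords (G : FreeAlg K n) (u : Fin n → List (Fin n)) : Prop where
  coeff_eq_one : ∀ j, (deltaL j G).coeff (FreeMonoid.ofList (u j)) = 1
  lt_of_coeff_ne_zero : ∀ j v, (deltaL j G).coeff (FreeMonoid.ofList v) ≠ 0 → v ≠ u j →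
    v.length = (u j).length ∧ wordValue v < wordValue (u j)

/-- Normal words span the truncated algebra: replace an occurrence of `u j` by the smaller words of
`δ_j G`. -/
theorem HasLeadingWords.mon_mem [NeZero n] {G : FreeAlg K n} {u : Fin n → List (Fin n)}
    (h : HasLeadingWords G u) (M : ℕ) (w : FreeMonoid (Fin n)) :
    mon K w ∈ Submodule.span K (mon K '' (FreeMonoid.ofList '' normalWords u M)) ⊔
      truncIdeal G M := by
  set W := Submodule.span K (mon K '' (FreeMonoid.ofList '' normalWords u M)) ⊔ truncIdeal G M
    with hW
  induction hN : wordValue w.toList using Nat.strong_induction_on generalizing w with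
  | _ N ih =>
    by_cases hlen : M ≤ w.length
    · exact Submodule.mem_sup_right (order_le_truncIdeal G M (mon_mem_order hlen))
    by_cases hnor : IsNormalWord u w.toList
    · exact Submodule.mem_sup_left (Submodule.subset_span ⟨w, ⟨w.toList, ⟨not_le.1 hlen, hnor⟩,
        rfl⟩, rfl⟩)
    obtain ⟨j, a, b, hab⟩ : ∃ j, u j <:+: w.toList := by simpa [IsNormalWord] using hnor
    obtain rfl : w = FreeMonoid.ofList a * FreeMonoid.ofList (u j) * FreeMonoid.ofList b :=
      hab.symm
    have h1 : mon K (FreeMonoid.ofList a) * deltaL j G * mon K (FreeMonoid.ofList b) ∈ W :=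
      Submodule.mem_sup_right (gen_mem_truncIdeal G M _ j _)
    have h2 : deltaL j G - mon K (FreeMonoid.ofList (u j)) ∈ MonoidAlgebra.supported K K
        {v : FreeMonoid (Fin n) | v.toList.length = (u j).length ∧
          wordValue v.toList < wordValue (u j)} := by
      rw [MonoidAlgebra.mem_supported']
      intro v hv
      by_contra hne
      by_cases hvu : v = FreeMonoid.ofList (u j)
      · apply hne
        rw [hvu, MonoidAlgebra.coeff_sub, Finsupp.sub_apply, h.coeff_eq_one]
        simp
      · refine hv (h.lt_of_coeff_ne_zero j v.toList (fun h0 => hne ?_) hvu)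
        rw [MonoidAlgebra.coeff_sub, Finsupp.sub_apply, MonoidAlgebra.coeff_single,
          Finsupp.single_eq_of_ne hvu, sub_zero]
        exact h0
    have h3 : MonoidAlgebra.supported K K
        {v : FreeMonoid (Fin n) | v.toList.length = (u j).length ∧
          wordValue v.toList < wordValue (u j)} ≤
        W.comap ((LinearMap.mulRight K (mon K (FreeMonoid.ofList b))).comp
          (LinearMap.mulLeft K (mon K (FreeMonoid.ofList a)))) := by
      rw [MonoidAlgebra.supported_eq_span_single, Submodule.span_le]
      rintro _ ⟨v, ⟨hv1, hv2⟩, rfl⟩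
      simp only [Submodule.comap_coe, Set.mem_preimage, LinearMap.comp_apply,
        LinearMap.mulLeft_apply, LinearMap.mulRight_apply, SetLike.mem_coe]
      rw [← mon_mul, ← mon_mul]
      refine ih _ ?_ _ rfl
      rw [← hN]
      simp only [FreeMonoid.toList_mul, FreeMonoid.toList_ofList]
      exact wordValue_append_right_lt b (wordValue_append_left_lt a hv1 hv2)
    have h4 := h3 h2
    simp only [Submodule.mem_comap, LinearMap.comp_apply, LinearMap.mulLeft_apply,
      LinearMap.mulRight_apply, mul_sub, sub_mul] at h4
    rw [mon_mul, mon_mul]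
    have := W.sub_mem h1 h4
    rwa [sub_sub_cancel] at this

theorem HasLeadingWords.truncDim_le [NeZero n] {G : FreeAlg K n} {u : Fin n → List (Fin n)}
    (h : HasLeadingWords G u) (M : ℕ) : truncDim G M ≤ (normalWords u M).ncard := by
  exact finrank_quotient_le_ncard (normalWords_finite u M) (h.mon_mem M)

/-- The sum of `truncIdeal F M` and the right ideal generated by `x_j`. -/
noncomputable def cokerIdeal (F : FreeAlg K n) (j : Fin n) (M : ℕ) : Submodule K (FreeAlg K n) :=
  truncIdeal F M ⊔ LinearMap.range (LinearMap.mulLeft K (X K j))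

theorem HasLeadingWords.finrank_coker_le [NeZero n] {G : FreeAlg K n}
    {u : Fin n → List (Fin n)} (h : HasLeadingWords G u) (x₀ : Fin n) (M : ℕ) :
    Module.finrank K (FreeAlg K n ⧸ cokerIdeal G x₀ M) ≤
      {w ∈ normalWords u M | ∀ t, w ≠ x₀ :: t}.ncard := by
  have hfin : {w ∈ normalWords u M | ∀ t, w ≠ x₀ :: t}.Finite :=
    (normalWords_finite u M).subset (Set.sep_subset _ _)
  refine finrank_quotient_le_ncard hfin fun w => ?_
  refine (sup_le ?_ ?_ : _ ≤ (_ : Submodule K (FreeAlg K n))) (h.mon_mem M w)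
  · rw [Submodule.span_le]
    rintro _ ⟨_, ⟨w, hw, rfl⟩, rfl⟩
    by_cases hx : ∀ t, w ≠ x₀ :: t
    · exact Submodule.mem_sup_left (Submodule.subset_span ⟨w, ⟨w, ⟨hw, hx⟩, rfl⟩, rfl⟩)
    · push Not at hx
      obtain ⟨t, rfl⟩ := hx
      refine Submodule.mem_sup_right (Submodule.mem_sup_right ⟨mon K (FreeMonoid.ofList t), ?_⟩)
      rw [LinearMap.mulLeft_apply, ← mon_of, ← mon_mul]
      rfl
  · exact le_sup_left.trans le_sup_right

end FreeAlg

/-! ### A potential whose leading words overlap once -/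

section Special

variable {n : ℕ}

open List

/-- The words obtained from `x^{k-2} i σ(i)`, `i ≠ x`, by cyclic rotation; here `k = e + 2`. -/
def IsRotatedWord (e : ℕ) (x : Fin n) (σ : Fin n → Fin n) (w : List (Fin n)) : Prop :=
  ∃ i, i ≠ x ∧ w ~r (replicate e x ++ [i, σ i])

/-- The words that lead in the partial derivatives of the sum of all words in `IsRotatedWord`:
`x^{k-3} y σ(y)` for `x` and `x^{k-2} σ(j)` for `j ≠ x`; here `k = e + 2`. -/
def leadWord (e : ℕ) (x y : Fin n) (σ : Fin n → Fin n) (j : Fin n) : List (Fin n) :=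
  if j = x then replicate (e - 1) x ++ [y, σ y] else replicate e x ++ [σ j]

theorem IsRotatedWord.cases {e : ℕ} {x : Fin n} {σ : Fin n → Fin n} {w : List (Fin n)}
    (h : IsRotatedWord e x σ w) : ∃ i, i ≠ x ∧
      ((∃ a b, a + b = e ∧ w = replicate a x ++ [i, σ i] ++ replicate b x) ∨
        w = σ i :: (replicate e x ++ [i])) := by
  obtain ⟨i, hi, hrot⟩ := h
  refine ⟨i, hi, ?_⟩
  obtain ⟨m, hm, rfl⟩ := (isRotated_iff_mem_map_range.1 hrot.symm |> List.mem_map.1)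
  rw [List.mem_range] at hm
  simp only [length_append, length_replicate, length_cons, length_nil] at hm
  have hm' : m ≤ (replicate e x ++ [i, σ i]).length := by simp; omega
  rw [rotate_eq_drop_append_take hm']
  rcases Nat.lt_or_ge e m with h1 | h1
  · obtain rfl | rfl : m = e + 1 ∨ m = e + 2 := by omega
    · right
      simp [drop_append, take_append]
    · left
      refine ⟨e, 0, by simp, ?_⟩
      simp [drop_append, take_append]
  · left
    refine ⟨e - m, m, by omega, ?_⟩
    simp [drop_append, take_append, h1, Nat.sub_eq_zero_of_le h1]

variable {e : ℕ} {x y : Fin n} {σ : Fin n → Fin n}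

theorem leadWord_length (he : 1 ≤ e) (j : Fin n) : (leadWord e x y σ j).length = e + 1 := by
  unfold leadWord
  split_ifs <;> simp
  omega

theorem leadWord_self : leadWord e x y σ x = replicate (e - 1) x ++ [y, σ y] := if_pos rfl

theorem leadWord_of_ne {j : Fin n} (hj : j ≠ x) : leadWord e x y σ j = replicate e x ++ [σ j] :=
  if_neg hj

/-- If `s` is a non-empty proper prefix of a leading word that ends in a letter other than `x`, then
it is `x^{k-3} y`, and the word is the leading word of `δ_x`. -/
theorem eq_of_prefix_leadWord {l : Fin n} {s : List (Fin n)}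
    {c : Fin n} (hc : c ≠ x) {r : List (Fin n)} (hr : r ≠ [])
    (h : s ++ [c] ++ r = leadWord e x y σ l) :
    l = x ∧ s = replicate (e - 1) x ∧ c = y ∧ r = [σ y] := by
  by_cases hl : l = x
  · subst hl
    refine ⟨rfl, ?_⟩
    rw [leadWord_self] at h
    obtain ⟨r', d, rfl⟩ := (eq_nil_or_concat' r).resolve_left hr
    have h' : (s ++ [c] ++ r') ++ [d] = (replicate (e - 1) l ++ [y]) ++ [σ y] := by
      simpa using h
    obtain ⟨h1, h2⟩ := append_inj' h' rfl
    rcases eq_nil_or_concat' r' with rfl | ⟨r'', d', rfl⟩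
    · rw [append_nil] at h1
      obtain ⟨h3, h4⟩ := append_inj' h1 rfl
      simp at h2 h4
      simp [h2, h3, h4]
    · exfalso
      have h1' : (s ++ [c] ++ r'') ++ [d'] = replicate (e - 1) l ++ [y] := by simpa using h1
      obtain ⟨h3, -⟩ := append_inj' h1' rfl
      have : c ∈ replicate (e - 1) l := by rw [← h3]; simp
      exact hc (eq_of_mem_replicate this)
  · exfalso
    rw [leadWord_of_ne hl] at h
    obtain ⟨r', d, rfl⟩ := (eq_nil_or_concat' r).resolve_left hr
    have h' : (s ++ [c] ++ r') ++ [d] = replicate e x ++ [σ l] := by simpa using h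
    obtain ⟨h3, -⟩ := append_inj' h' rfl
    have : c ∈ replicate e x := by rw [← h3]; simp
    exact hc (eq_of_mem_replicate this)

/-- The only overlap is that of `u (σ y) = x^{k-2} y` with `u x = x^{k-3} y σ(y)`, in the block
`x^{k-3} y`. -/
theorem hasSingleOverlap_leadWord (he : 1 ≤ e) {x₀ : Fin n} (hx₀ : x ≠ x₀) (hyx : y ≠ x)
    (hσ : Function.Involutive σ) (hσx : ∀ i, i ≠ x → σ i ≠ x)
    (hcase : 2 ≤ e ∨ (σ y ≠ y ∧ y ≠ x₀)) :
    HasSingleOverlap e x₀ (leadWord e x y σ) where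
  length_eq := leadWord_length he
  injective := by
    intro i j hij
    by_cases hi : i = x <;> by_cases hj : j = x
    · rw [hi, hj]
    · exfalso
      have := eq_of_prefix_leadWord (l := j) (s := replicate (e - 1) x) (c := y) (r := [σ y])
        (x := x) (y := y) (σ := σ) hyx (by simp) (by rw [← hij, hi, leadWord_self]; simp)
      exact hj this.1
    · exfalso
      have := eq_of_prefix_leadWord (l := i) (s := replicate (e - 1) x) (c := y) (r := [σ y])
        (x := x) (y := y) (σ := σ) hyx (by simp) (by rw [hij, hj, leadWord_self]; simp)
      exact hi this.1
    · rw [leadWord_of_ne hi, leadWord_of_ne hj] at hij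
      have := append_cancel_left hij
      simp at this
      exact hσ.injective this
  head_ne := by
    intro j t h
    obtain ⟨e, rfl⟩ : ∃ f, e = f + 1 := ⟨e - 1, by omega⟩
    by_cases hj : j = x
    · rw [hj, leadWord_self] at h
      rcases hcase with hc | hc
      · obtain ⟨f, rfl⟩ : ∃ f, e = f + 1 := ⟨e - 1, by omega⟩
        simp [replicate_succ] at h
        exact hx₀ h.1
      · rcases e with _ | e
        · simp at h
          exact hc.2 h.1
        · simp [replicate_succ] at h
          exact hx₀ h.1
    · rw [leadWord_of_ne hj] at h
      simp [replicate_succ] at h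
      exact hx₀ h.1
  overlap := by
    refine ⟨σ y, σ y, fun j v hv hnv => ?_⟩
    obtain ⟨l, a, b, hab⟩ : ∃ l, leadWord e x y σ l <:+: (leadWord e x y σ j).tail ++ v := by
      simpa [IsNormalWord] using hnv
    -- the occurrence begins inside the tail of `u j`, since `v` is normal
    rw [append_assoc] at hab
    obtain ⟨s, hs, hsv⟩ : ∃ s, (leadWord e x y σ j).tail = a ++ s ∧
        leadWord e x y σ l ++ b = s ++ v := by
      rcases append_eq_append_iff.1 hab with ⟨s, h1, h2⟩ | ⟨s, h1, h2⟩
      · exact ⟨s, h1, h2⟩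
      · exact absurd ⟨s, b, by rw [append_assoc, h2]⟩ (hv l)
    have hslen : s.length ≤ e := by
      have := congrArg length hs
      rw [length_tail, leadWord_length he, length_append] at this
      omega
    obtain ⟨r, hr, hvr⟩ : ∃ r, leadWord e x y σ l = s ++ r ∧ v = r ++ b := by
      rcases append_eq_append_iff.1 hsv with ⟨r, h1, h2⟩ | ⟨r, h1, h2⟩
      · have := congrArg length h1
        rw [length_append, leadWord_length he] at this
        have hr : r = [] := by
          apply length_eq_zero_iff.1
          omega
        subst hr
        refine ⟨[], by simpa using h1.symm, by simpa using h2.symm⟩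
      · exact ⟨r, h1, h2⟩
    have hrne : r ≠ [] := by
      rintro rfl
      have := congrArg length hr
      rw [leadWord_length he, append_nil] at this
      omega
    have hsne : s ≠ [] := by
      rintro rfl
      refine hv l ⟨[], b, ?_⟩
      rw [hr, hvr]; simp
    obtain ⟨s', c, rfl⟩ := (eq_nil_or_concat' s).resolve_left hsne
    -- the tail of `u j` ends with a letter other than `x`
    have hlast : ∃ t c', c' ≠ x ∧ leadWord e x y σ j = t ++ [c'] ∧ (j ≠ x → c' = σ j) ∧
        (j = x → c' = σ y ∧ t = replicate (e - 1) x ++ [y]) := by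
      by_cases hj : j = x
      · exact ⟨_, _, hσx y hyx, by rw [hj, leadWord_self, append_cons], fun h => (h hj).elim,
          fun _ => ⟨rfl, rfl⟩⟩
      · exact ⟨_, _, hσx j hj, leadWord_of_ne hj, fun _ => rfl, fun h => (hj h).elim⟩
    obtain ⟨t, c', hc', htc, hcj, htj⟩ := hlast
    have htne : t ≠ [] := by
      rintro rfl
      have := leadWord_length (x := x) (y := y) (σ := σ) he j
      rw [htc] at this
      simp at this
      omega
    have htail : t.tail ++ [c'] = a ++ s' ++ [c] := by
      rw [htc, tail_append_of_ne_nil htne] at hs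
      simpa using hs
    obtain ⟨hts, hcc⟩ := append_inj' htail rfl
    obtain rfl : c' = c := by simpa using hcc
    obtain ⟨rfl, hs', hcy, hrσ⟩ := eq_of_prefix_leadWord hc' hrne hr.symm
    refine ⟨?_, b, by rw [hvr, hrσ]; rfl⟩
    by_cases hj : j = l
    · exfalso
      obtain ⟨h1, h2⟩ := htj hj
      rcases hcase with hc | hc
      · -- the letter before the last one is `y` on one side and `x` on the other
        obtain ⟨f, rfl⟩ : ∃ f, e = f + 2 := ⟨e - 2, by omega⟩
        rw [h2, hs'] at hts
        simp only [Nat.add_succ_sub_one, replicate_succ, cons_append, tail_cons] at hts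
        rw [← replicate_succ, replicate_succ', ← append_assoc] at hts
        have := (append_inj' hts rfl).2
        simp at this
        exact hyx this
      · exact hc.1 (h1.symm.trans hcy)
    · rw [← hcy, hcj hj, hσ]

end Special

namespace FreeAlg

open List

variable {K : Type*} [Field K] {n : ℕ} {e : ℕ} {x y : Fin n} {σ : Fin n → Fin n}

open Classical in
/-- The sum of all cyclic rotations of the words `x^{k-2} i σ(i)`, `i ≠ x`; here `k = e + 2`. -/
noncomputable def rotationSum (K : Type*) [Field K] (e : ℕ) (x : Fin n) (σ : Fin n → Fin n) :
    FreeAlg K n :=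
  MonoidAlgebra.ofCoeff (Finsupp.ofSupportFinite
    (fun w => if IsRotatedWord e x σ w.toList then 1 else 0)
    ((finite_words_lt n (e + 3)).subset fun w hw => by
      have hw' : IsRotatedWord e x σ w.toList := by
        by_contra h
        exact hw (if_neg h)
      obtain ⟨i, -, h⟩ := hw'
      have := h.perm.length_eq
      simp only [length_append, length_replicate, length_cons, length_nil] at this
      change w.toList.length < e + 3
      omega))

open Classical in
theorem coeff_rotationSum (w : FreeMonoid (Fin n)) :
    (rotationSum K e x σ).coeff w = if IsRotatedWord e x σ w.toList then 1 else 0 := rfl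

theorem isRotatedWord_of_coeff_rotationSum_ne_zero {w : FreeMonoid (Fin n)}
    (h : (rotationSum K e x σ).coeff w ≠ 0) : IsRotatedWord e x σ w.toList := by
  by_contra h'
  exact h (by rw [coeff_rotationSum, if_neg h'])

theorem rotationSum_mem_potentials {m : ℕ} (hm : e + 2 ≤ m) :
    rotationSum K e x σ ∈ potentials K n (e + 2) m := by
  refine ⟨fun u v => ?_, fun w hw => ?_⟩
  · rw [coeff_rotationSum, coeff_rotationSum]
    congr 1
    have h : (u * v).toList ~r (v * u).toList := by
      rw [FreeMonoid.toList_mul, FreeMonoid.toList_mul]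
      exact isRotated_append
    exact propext ⟨fun ⟨i, hi, h'⟩ => ⟨i, hi, h.symm.trans h'⟩,
      fun ⟨i, hi, h'⟩ => ⟨i, hi, h.trans h'⟩⟩
  · obtain ⟨i, -, h⟩ := isRotatedWord_of_coeff_rotationSum_ne_zero hw
    have := h.perm.length_eq
    simp only [length_append, length_replicate, length_cons, length_nil] at this
    change e + 2 ≤ w.toList.length ∧ w.toList.length ≤ m
    omega

/-- Every word of `δ_j` of the rotation sum other than the leading one has a letter smaller than `x`
where the leading word has `x`, or else `i < y` where the leading word has `y`. -/
theorem hasLeadingWords_rotationSum (he : 1 ≤ e) (hyx : y ≠ x) (hx : ∀ i, i ≤ x)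
    (hy : ∀ i, i ≠ x → i ≤ y) (hσ : Function.Involutive σ) (hσx : ∀ i, i ≠ x → σ i ≠ x) :
    HasLeadingWords (rotationSum K e x σ) (leadWord e x y σ) where
  coeff_eq_one := by
    intro j
    rw [coeff_deltaL, coeff_rotationSum, if_pos]
    rw [FreeMonoid.toList_mul, FreeMonoid.toList_of, FreeMonoid.toList_ofList]
    by_cases hj : j = x
    · subst hj
      refine ⟨y, hyx, ?_⟩
      obtain ⟨f, rfl⟩ : ∃ f, e = f + 1 := ⟨e - 1, by omega⟩
      rw [leadWord_self]
      simp [replicate_succ, IsRotated.refl]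
    · refine ⟨σ j, hσx j hj, ?_⟩
      rw [leadWord_of_ne hj, hσ j]
      have := isRotated_append (l := [j]) (l' := replicate e x ++ [σ j])
      simpa using this
  lt_of_coeff_ne_zero := by
    intro j v hv hne
    rw [coeff_deltaL] at hv
    obtain ⟨i, hi, ⟨a, b, hab, h⟩ | h⟩ := (isRotatedWord_of_coeff_rotationSum_ne_zero hv).cases <;>
      rw [FreeMonoid.toList_mul, FreeMonoid.toList_of, FreeMonoid.toList_ofList,
        singleton_append] at h
    · rw [leadWord_length he]
      rcases a with _ | a
      · simp only [replicate_zero, nil_append, cons_append, cons.injEq] at h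
        obtain ⟨rfl, rfl⟩ := h
        obtain rfl : b = e := by omega
        obtain ⟨f, rfl⟩ : ∃ f, b = f + 1 := ⟨b - 1, by omega⟩
        refine ⟨by simp, ?_⟩
        rw [leadWord_of_ne hi, replicate_succ, cons_append]
        exact wordValue_cons_lt ((hx _).lt_of_ne (hσx _ hi)) (by simp)
      · simp only [replicate_succ, cons_append, cons.injEq] at h
        obtain ⟨rfl, rfl⟩ := h
        refine ⟨by simp; omega, ?_⟩
        rw [leadWord_self] at hne ⊢
        obtain ⟨f, rfl⟩ : ∃ f, e = f + 1 := ⟨e - 1, by omega⟩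
        rcases b with _ | b
        · obtain rfl : a = f := by omega
          rw [replicate_zero, append_nil]
          refine wordValue_append_left_lt _ rfl (wordValue_cons_lt ?_ rfl)
          refine (hy i hi).lt_of_ne ?_
          rintro rfl
          exact hne (by simp)
        · obtain rfl : f = a + (b + 1) := by omega
          rw [Nat.add_sub_cancel, replicate_add a, append_assoc, append_assoc]
          refine wordValue_append_left_lt _ (by simp) ?_
          rw [replicate_succ (n := b), cons_append, cons_append]
          exact wordValue_cons_lt ((hx _).lt_of_ne hi) (by simp)
    · exfalso
      simp only [cons.injEq] at h
      obtain ⟨rfl, rfl⟩ := h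
      apply hne
      rw [leadWord_of_ne (hσx i hi), hσ i]

/-- The largest letter plays the role of `x`. For `k ≥ 4` the involution can be the identity; for
`k = 3` it has to move the second largest letter `y`, as the leading word `y σ(y)` must not be a
square, and then a third letter is needed. -/
theorem exists_potential_hasLeadingWords (K : Type*) [Field K] {n k m : ℕ} (hn : 2 ≤ n)
    (hk : 3 ≤ k) (hkm : k ≤ m) (hnk : (n, k) ≠ (2, 3)) {x₀ : Fin n} (hx₀ : (x₀ : ℕ) = 0) :
    ∃ G ∈ potentials K n k m, ∃ u, HasLeadingWords G u ∧ HasSingleOverlap (k - 2) x₀ u := by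
  obtain ⟨e, rfl⟩ : ∃ e, k = e + 2 := ⟨k - 2, by omega⟩
  let x : Fin n := ⟨n - 1, by omega⟩
  let y : Fin n := ⟨n - 2, by omega⟩
  have hyx : y ≠ x := by simp only [x, y, ne_eq, Fin.mk.injEq]; omega
  have hx : ∀ i, i ≤ x := fun i => by simp only [x, Fin.le_def]; omega
  have hy : ∀ i, i ≠ x → i ≤ y := fun i hi => by
    simp only [x, y, Fin.le_def, ne_eq, Fin.ext_iff] at *; omega
  have hxx₀ : x ≠ x₀ := by simp only [x, ne_eq, Fin.ext_iff]; omega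
  obtain ⟨σ, hσ, hσx, hcase⟩ : ∃ σ : Fin n → Fin n, Function.Involutive σ ∧
      (∀ i, i ≠ x → σ i ≠ x) ∧ (2 ≤ e ∨ (σ y ≠ y ∧ y ≠ x₀)) := by
    by_cases he : 2 ≤ e
    · exact ⟨id, fun _ => rfl, fun _ h => h, Or.inl he⟩
    · obtain rfl : e = 1 := by omega
      have hn3 : 3 ≤ n := by
        by_contra h
        exact hnk (by simp; omega)
      let z : Fin n := ⟨n - 3, by omega⟩
      have hzx : z ≠ x := by simp only [x, z, ne_eq, Fin.mk.injEq]; omega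
      refine ⟨Equiv.swap y z, fun i => Equiv.swap_apply_self y z i, fun i hi h => ?_,
        Or.inr ⟨?_, ?_⟩⟩
      · rw [Equiv.swap_apply_eq_iff, Equiv.swap_apply_of_ne_of_ne hyx.symm hzx.symm] at h
        exact hi h
      · rw [Equiv.swap_apply_left]
        simp only [y, z, ne_eq, Fin.mk.injEq]; omega
      · simp only [y, ne_eq, Fin.ext_iff]; omega
  exact ⟨rotationSum K e x σ, rotationSum_mem_potentials hkm, leadWord e x y σ,
    hasLeadingWords_rotationSum (by omega) hyx hx hy hσ hσx,
    hasSingleOverlap_leadWord (by omega) hxx₀ hyx hσ hσx hcase⟩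

end FreeAlg

/-! ### The dimensions of the truncations for generic potentials -/

namespace FreeAlg

variable {K : Type*} [Field K] {n : ℕ}

theorem mem_order_of_mem_potentials {k m : ℕ} {F : FreeAlg K n} (hF : F ∈ potentials K n k m) :
    F ∈ order K n k := by
  rw [mem_order]
  intro w hw
  by_contra h
  exact absurd (hF.2 w h).1 (not_le.2 hw)

theorem exists_mvPolynomial_truncDim_le {P : Submodule K (FreeAlg K n)} (F₀ : P) (M : ℕ) :
    ∃ p : MvPolynomial (Module.Dual K P) K,
      MvPolynomial.eval (fun φ : Module.Dual K P => φ F₀) p ≠ 0 ∧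
      ∀ F : P, MvPolynomial.eval (fun φ : Module.Dual K P => φ F) p ≠ 0 →
        truncDim (F : FreeAlg K n) M ≤ truncDim (F₀ : FreeAlg K n) M := by
  have := finite_quotient_order (K := K) (n := n) M
  exact exists_mvPolynomial_finrank_quotient_le (order K n M)
    (fun t : FreeMonoid (Fin n) × Fin n × FreeMonoid (Fin n) =>
      ((LinearMap.mulRight K (mon K t.2.2)).comp
        ((LinearMap.mulLeft K (mon K t.1)).comp (deltaL t.2.1))).comp P.subtype) F₀

theorem cokerIdeal_eq (F : FreeAlg K n) (j : Fin n) (M : ℕ) :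
    cokerIdeal F j M = (order K n M ⊔ LinearMap.range (LinearMap.mulLeft K (X K j))) ⊔
      Submodule.span K (Set.range fun t : FreeMonoid (Fin n) × Fin n × FreeMonoid (Fin n) =>
        mon K t.1 * deltaL t.2.1 F * mon K t.2.2) :=
  sup_right_comm _ _ _

theorem exists_mvPolynomial_finrank_coker_le {P : Submodule K (FreeAlg K n)} (F₀ : P) (j : Fin n)
    (M : ℕ) :
    ∃ p : MvPolynomial (Module.Dual K P) K,
      MvPolynomial.eval (fun φ : Module.Dual K P => φ F₀) p ≠ 0 ∧
      ∀ F : P, MvPolynomial.eval (fun φ : Module.Dual K P => φ F) p ≠ 0 →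
        Module.finrank K (FreeAlg K n ⧸ cokerIdeal (F : FreeAlg K n) j M) ≤
          Module.finrank K (FreeAlg K n ⧸ cokerIdeal (F₀ : FreeAlg K n) j M) := by
  have := finite_quotient_of_order_le (K := K) (n := n) (M := M)
    (W := order K n M ⊔ LinearMap.range (LinearMap.mulLeft K (X K j))) le_sup_left
  obtain ⟨p, hp, hp'⟩ := exists_mvPolynomial_finrank_quotient_le
    (order K n M ⊔ LinearMap.range (LinearMap.mulLeft K (X K j)))
    (fun t : FreeMonoid (Fin n) × Fin n × FreeMonoid (Fin n) =>
      ((LinearMap.mulRight K (mon K t.2.2)).comp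
        ((LinearMap.mulLeft K (mon K t.1)).comp (deltaL t.2.1))).comp P.subtype) F₀
  refine ⟨p, hp, fun F hF => ?_⟩
  rw [cokerIdeal_eq, cokerIdeal_eq]
  exact hp' F hF

/-- A dimension count for left multiplication by `x_j` between consecutive truncations. -/
theorem mem_truncIdeal_of_X_mul_mem {F : FreeAlg K n} {j : Fin n} {M : ℕ}
    (h : Module.finrank K (FreeAlg K n ⧸ cokerIdeal F j (M + 1)) + truncDim F M ≤
      truncDim F (M + 1)) {f : FreeAlg K n} (hf : X K j * f ∈ truncIdeal F (M + 1)) :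
    f ∈ truncIdeal F M := by
  have hX : truncIdeal F M ≤ (truncIdeal F (M + 1)).comap (LinearMap.mulLeft K (X K j)) :=
    fun f hf => X_mul_mem_truncIdeal j hf
  set μ := Submodule.mapQ _ _ _ hX with hμ
  have hrange : LinearMap.range μ = (cokerIdeal F j (M + 1)).map (truncIdeal F (M + 1)).mkQ := by
    rw [cokerIdeal, Submodule.map_sup, Submodule.mkQ_map_self, bot_sup_eq, hμ, Submodule.range_mapQ]
  have e1 := Submodule.finrank_quotient_add_finrank (LinearMap.range μ)
  have e2 : Module.finrank K (_ ⧸ LinearMap.range μ) =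
      Module.finrank K (FreeAlg K n ⧸ cokerIdeal F j (M + 1)) := by
    rw [hrange]
    exact (Submodule.quotientQuotientEquivQuotient _ _ le_sup_left).finrank_eq
  have e3 := LinearMap.finrank_range_add_finrank_ker μ
  have hker : LinearMap.ker μ = ⊥ := by
    rw [← Submodule.finrank_eq_zero (R := K)]
    unfold truncDim at h
    omega
  have : (truncIdeal F M).mkQ f ∈ LinearMap.ker μ := by
    rw [LinearMap.mem_ker, hμ, Submodule.mkQ_apply, Submodule.mapQ_apply, LinearMap.mulLeft_apply,
      Submodule.Quotient.mk_eq_zero]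
    exact hf
  rw [hker, Submodule.mem_bot] at this
  simpa using this

/-- In degrees where the relations are not yet visible, all words are linearly independent. -/
theorem ncard_normalWords_le_truncDim_of_le {d M : ℕ} {F : FreeAlg K n}
    (hF : F ∈ order K n (d + 2)) (hM : M ≤ d + 1) (u : Fin n → List (Fin n)) :
    (normalWords u M).ncard ≤ truncDim F M := by
  have hfin : Finite (normalWords u M) := normalWords_finite u M
  have := Fintype.ofFinite (normalWords u M)
  have htr : truncIdeal F M ≤ order K n M := by
    refine truncIdeal_le (fun w hw => mon_mem_order hw) fun a j b => ?_
    have h1 := deltaL_mem_order hF j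
    have h2 := mul_mem_order (mul_mem_order (mon_mem_order (K := K) (Nat.zero_le a.length)) h1)
      (mon_mem_order (K := K) (Nat.zero_le b.length))
    exact order_anti (by omega) h2
  let Φ : FreeAlg K n →ₗ[K] (normalWords u M → K) :=
    { toFun := fun f w => f.coeff (FreeMonoid.ofList w.1)
      map_add' := fun _ _ => rfl
      map_smul' := fun _ _ => rfl }
  have hΦw : ∀ f w, Φ f w = f.coeff (FreeMonoid.ofList w.1) := fun _ _ => rfl
  have hΦ : truncIdeal F M ≤ LinearMap.ker Φ := by
    intro f hf
    rw [LinearMap.mem_ker]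
    ext w
    exact mem_order.1 (htr hf) _ w.2.1
  have hsurj : Function.Surjective Φ := by
    intro c
    refine ⟨∑ w, c w • mon K (FreeMonoid.ofList w.1), ?_⟩
    ext w
    rw [map_sum, Finset.sum_apply, Finset.sum_eq_single w]
    · simp [hΦw]
    · intro v _ hv
      have : FreeMonoid.ofList w.1 ≠ FreeMonoid.ofList v.1 := fun h =>
        hv (Subtype.ext (FreeMonoid.ofList.injective h).symm)
      simp [hΦw, Finsupp.single_eq_of_ne this]
    · simp
  have h1 := LinearMap.finrank_le_finrank_of_surjective (f := Submodule.liftQ _ Φ hΦ) (by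
    rw [← LinearMap.range_eq_top, Submodule.range_liftQ, LinearMap.range_eq_top]
    exact hsurj)
  rw [Module.finrank_fintype_fun_eq_card, ← Nat.card_eq_fintype_card] at h1
  exact h1

section Bounds

variable {d m : ℕ} {x₀ : Fin n} {u : Fin n → List (Fin n)} {G : FreeAlg K n}

/-- The truncations of the special potential have the smallest dimensions possible. In the
inductive step the recursive inequality needs left multiplication by `x₀` to be injective in lower
degrees; this holds after moving `F` to a generic position without increasing the dimension. -/
theorem ncard_normalWords_le_truncDim [Infinite K] (hG : G ∈ potentials K n (d + 2) m)
    (hu : HasLeadingWords G u) (hov : HasSingleOverlap d x₀ u) (M : ℕ)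
    (F : potentials K n (d + 2) m) :
    (normalWords u M).ncard ≤ truncDim (F : FreeAlg K n) M := by
  have : NeZero n := ⟨(Fin.pos x₀).ne'⟩
  induction M using Nat.strong_induction_on generalizing F with
  | _ M ih =>
    rcases Nat.lt_or_ge M (d + 2) with hM | hM
    · exact ncard_normalWords_le_truncDim_of_le (mem_order_of_mem_potentials F.2)
        (Nat.lt_succ_iff.1 hM) u
    obtain ⟨r, rfl⟩ : ∃ r, M = r + d + 2 := ⟨M - (d + 2), by omega⟩
    obtain ⟨p₁, hp₁, hp₁'⟩ := exists_mvPolynomial_truncDim_le F (r + d + 2)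
    obtain ⟨p₂, hp₂, hp₂'⟩ := exists_mvPolynomial_truncDim_le
      (⟨G, hG⟩ : potentials K n (d + 2) m) r
    obtain ⟨p₃, hp₃, hp₃'⟩ := exists_mvPolynomial_truncDim_le
      (⟨G, hG⟩ : potentials K n (d + 2) m) (r + 1)
    obtain ⟨p₄, hp₄, hp₄'⟩ := exists_mvPolynomial_finrank_coker_le
      (⟨G, hG⟩ : potentials K n (d + 2) m) x₀ (r + 1)
    obtain ⟨F', hF'⟩ := exists_eval_mul_ne_zero (q := p₂ * p₃ * p₄) hp₁ (by
      rw [map_mul, map_mul]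
      exact mul_ne_zero (mul_ne_zero hp₂ hp₃) hp₄)
    simp only [map_mul, mul_ne_zero_iff] at hF'
    obtain ⟨h₁, ⟨h₂, h₃⟩, h₄⟩ := hF'
    have b₁ := hp₁' F' h₁
    have b₂ := (hp₂' F' h₂).trans (hu.truncDim_le r)
    have b₃ := (hp₃' F' h₃).trans (hu.truncDim_le (r + 1))
    have b₄ := (hp₄' F' h₄).trans (hu.finrank_coker_le x₀ (r + 1))
    have c₁ := hov.ncard_add_ncard_le r
    have c₂ := hov.card_normalWords_le r
    have i₁ := ih (r + 1) (by omega) F'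
    have i₂ := ih (r + d + 1) (by omega) F'
    have i₃ := ih r (by omega) F'
    have hrec := truncDim_recursion (m := r) x₀ F'.2.1 (mem_order_of_mem_potentials F'.2)
      (fun f hf => mem_truncIdeal_of_X_mul_mem (by omega) hf)
    have j₁ := Nat.mul_le_mul_left n i₂
    have j₂ := Nat.mul_le_mul_left n b₃
    omega

/-- For generic `F`, left multiplication by `x₀` is injective on all truncations. -/
theorem exists_mvPolynomial_X_mul_mem [Infinite K] (hG : G ∈ potentials K n (d + 2) m)
    (hu : HasLeadingWords G u) (hov : HasSingleOverlap d x₀ u) (M : ℕ) :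
    ∃ p : MvPolynomial (Module.Dual K (potentials K n (d + 2) m)) K,
      (∃ F₀ : potentials K n (d + 2) m, MvPolynomial.eval (fun φ => φ F₀) p ≠ 0) ∧
      ∀ F : potentials K n (d + 2) m, MvPolynomial.eval (fun φ => φ F) p ≠ 0 →
        ∀ f, X K x₀ * f ∈ truncIdeal (F : FreeAlg K n) (M + 1) →
          f ∈ truncIdeal (F : FreeAlg K n) M := by
  have : NeZero n := ⟨(Fin.pos x₀).ne'⟩
  obtain ⟨p₁, hp₁, hp₁'⟩ := exists_mvPolynomial_truncDim_le
    (⟨G, hG⟩ : potentials K n (d + 2) m) M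
  obtain ⟨p₂, hp₂, hp₂'⟩ := exists_mvPolynomial_finrank_coker_le
    (⟨G, hG⟩ : potentials K n (d + 2) m) x₀ (M + 1)
  refine ⟨p₁ * p₂, ⟨⟨G, hG⟩, by rw [map_mul]; exact mul_ne_zero hp₁ hp₂⟩, fun F hF f hf => ?_⟩
  rw [map_mul, mul_ne_zero_iff] at hF
  have b₁ := (hp₁' F hF.1).trans (hu.truncDim_le M)
  have b₂ := (hp₂' F hF.2).trans (hu.finrank_coker_le x₀ (M + 1))
  have c := hov.ncard_add_ncard_le M
  have i := ncard_normalWords_le_truncDim hG hu hov (M + 1) F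
  exact mem_truncIdeal_of_X_mul_mem (by omega) hf

end Bounds

end FreeAlg

/-! ### From the truncations to the two completed algebras -/

namespace FreeAlg

variable {K : Type*} [Field K] {n : ℕ}

/-- `truncIdeal F M` as a two-sided ideal. -/
noncomputable def truncTwoSided (F : FreeAlg K n) (M : ℕ) : TwoSidedIdeal (FreeAlg K n) :=
  TwoSidedIdeal.mk' (truncIdeal F M) (truncIdeal F M).zero_mem (truncIdeal F M).add_mem
    (truncIdeal F M).neg_mem (mul_mem_truncIdeal_left _) (mul_mem_truncIdeal_right _)

theorem mem_truncTwoSided {F : FreeAlg K n} {M : ℕ} {f : FreeAlg K n} :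
    f ∈ truncTwoSided F M ↔ f ∈ truncIdeal F M := by
  simp only [truncTwoSided, TwoSidedIdeal.mem_mk', SetLike.mem_coe]

theorem smul_mem_twoSidedIdeal (I : TwoSidedIdeal (FreeAlg K n)) (c : K) {f : FreeAlg K n}
    (hf : f ∈ I) : c • f ∈ I := by
  have := I.mul_mem_left (c • 1) f hf
  rwa [smul_mul_assoc, one_mul] at this

theorem truncIdeal_le_twoSidedIdeal {F : FreeAlg K n} {M : ℕ} {I : TwoSidedIdeal (FreeAlg K n)}
    (h₁ : ∀ w : FreeMonoid (Fin n), M ≤ w.length → mon K w ∈ I) (h₂ : ∀ j, delta j F ∈ I)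
    {f : FreeAlg K n} (hf : f ∈ truncIdeal F M) : f ∈ I := by
  let W : Submodule K (FreeAlg K n) :=
    { carrier := I
      zero_mem' := I.zero_mem
      add_mem' := I.add_mem
      smul_mem' := fun c _ h => smul_mem_twoSidedIdeal I c h }
  have : truncIdeal F M ≤ W :=
    truncIdeal_le h₁ fun u j v => I.mul_mem_right _ _ (I.mul_mem_left _ _ (h₂ j))
  exact this hf

theorem delta_mem_truncIdeal (F : FreeAlg K n) (j : Fin n) (M : ℕ) :
    delta j F ∈ truncIdeal F M := by
  have := gen_mem_truncIdeal F M 1 j 1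
  rwa [mon_one, one_mul, mul_one] at this

theorem mem_relIdeal_sup_highDegree {F : FreeAlg K n} {N : ℕ} {f : FreeAlg K n} :
    f ∈ relIdeal F ⊔ highDegree K n N ↔ f ∈ truncIdeal F (N + 1) := by
  constructor
  · intro hf
    rw [← mem_truncTwoSided]
    refine (sup_le ?_ ?_ : relIdeal F ⊔ highDegree K n N ≤ truncTwoSided F (N + 1)) hf
    · refine TwoSidedIdeal.span_le.2 ?_
      rintro _ ⟨j, rfl⟩
      exact mem_truncTwoSided.2 (delta_mem_truncIdeal F j _)
    · refine TwoSidedIdeal.span_le.2 ?_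
      rintro _ ⟨w, hw, rfl⟩
      exact mem_truncTwoSided.2 (order_le_truncIdeal F _ (mon_mem_order hw))
  · refine truncIdeal_le_twoSidedIdeal (fun w hw => ?_) fun j => ?_
    · exact TwoSidedIdeal.mem_sup_right (TwoSidedIdeal.subset_span ⟨w, hw, rfl⟩)
    · exact TwoSidedIdeal.mem_sup_left (TwoSidedIdeal.subset_span ⟨j, rfl⟩)

theorem mem_completedIdeal {F : FreeAlg K n} {f : FreeAlg K n} :
    f ∈ completedIdeal F ↔ ∀ M, f ∈ truncIdeal F M := by
  rw [completedIdeal, TwoSidedIdeal.mem_iInf]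
  simp_rw [mem_relIdeal_sup_highDegree]
  exact ⟨fun h M => truncIdeal_anti F (Nat.le_succ M) (h M), fun h N => h _⟩

end FreeAlg

namespace NCSeries

variable {K : Type*} [Field K] {n : ℕ}

open FreeAlg

theorem coeff_ofFreeAlg (f : FreeAlg K n) (w : FreeMonoid (Fin n)) :
    (ofFreeAlg f).coeff w = f.coeff w := rfl

theorem coeff_sub (f g : NCSeries K n) (w : FreeMonoid (Fin n)) :
    (f - g).coeff w = f.coeff w - g.coeff w := by
  rw [sub_eq_add_neg, coeff_add, coeff_neg, sub_eq_add_neg]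

theorem ofFreeAlg_mul (f g : FreeAlg K n) : ofFreeAlg (f * g) = ofFreeAlg f * ofFreeAlg g := by
  classical
  ext w
  rw [coeff_mul, coeff_ofFreeAlg]
  exact MonoidAlgebra.coeff_mul_antidiag f g w (wordSplits w) mem_wordSplits

/-- Noncommutative polynomials as a subring of the formal power series. -/
def ofFreeAlgHom (K : Type*) [Field K] (n : ℕ) : FreeAlg K n →+* NCSeries K n where
  toFun := ofFreeAlg
  map_zero' := rfl
  map_add' _ _ := rfl
  map_mul' := ofFreeAlg_mul
  map_one' := by
    classical
    ext w
    rw [coeff_ofFreeAlg, coeff_one, MonoidAlgebra.one_def, MonoidAlgebra.coeff_single,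
      Finsupp.single_apply]
    simp only [FreeMonoid.length_eq_zero, eq_comm]

open Classical in
/-- The truncation of a formal power series to the words of length less than `M`. -/
noncomputable def trunc (M : ℕ) (f : NCSeries K n) : FreeAlg K n :=
  MonoidAlgebra.ofCoeff (Finsupp.ofSupportFinite
    (fun w => if w.length < M then f.coeff w else 0)
    ((finite_words_lt n M).subset fun w hw => by
      by_contra h
      exact hw (if_neg h)))

theorem coeff_trunc_of_lt {M : ℕ} (f : NCSeries K n) {w : FreeMonoid (Fin n)} (hw : w.length < M) :
    (trunc M f).coeff w = f.coeff w := if_pos hw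

theorem trunc_add (M : ℕ) (f g : NCSeries K n) : trunc M (f + g) = trunc M f + trunc M g := by
  apply MonoidAlgebra.coeff_injective
  ext w
  change (if w.length < M then (f + g).coeff w else 0) =
    (if w.length < M then f.coeff w else 0) + (if w.length < M then g.coeff w else 0)
  split_ifs <;> simp [coeff_add]

theorem trunc_neg (M : ℕ) (f : NCSeries K n) : trunc M (-f) = -trunc M f := by
  apply MonoidAlgebra.coeff_injective
  ext w
  change (if w.length < M then (-f).coeff w else 0) = -(if w.length < M then f.coeff w else 0)
  split_ifs <;> simp [coeff_neg]

theorem trunc_zero (M : ℕ) : trunc M (0 : NCSeries K n) = 0 := by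
  apply MonoidAlgebra.coeff_injective
  ext w
  change (if w.length < M then (0 : NCSeries K n).coeff w else 0) = 0
  split_ifs <;> simp [coeff_zero]

/-- Truncation is multiplicative modulo words of length at least `M`. -/
theorem trunc_mul_sub_mem_order (M : ℕ) (f g : NCSeries K n) :
    trunc M (f * g) - trunc M f * trunc M g ∈ order K n M := by
  classical
  rw [mem_order]
  intro w hw
  rw [MonoidAlgebra.coeff_sub, Finsupp.sub_apply, coeff_trunc_of_lt _ hw, coeff_mul,
    MonoidAlgebra.coeff_mul_antidiag _ _ w (wordSplits w) mem_wordSplits, sub_eq_zero]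
  refine Finset.sum_congr rfl fun p hp => ?_
  rw [mem_wordSplits] at hp
  rw [← hp, FreeMonoid.length_mul] at hw
  rw [coeff_trunc_of_lt _ (by omega), coeff_trunc_of_lt _ (by omega)]

theorem trunc_ofFreeAlg_sub_mem_order (M : ℕ) (f : FreeAlg K n) :
    trunc M (ofFreeAlg f) - f ∈ order K n M := by
  rw [mem_order]
  intro w hw
  rw [MonoidAlgebra.coeff_sub, Finsupp.sub_apply, coeff_trunc_of_lt _ hw, coeff_ofFreeAlg, sub_self]

theorem trunc_mul_mem_iff {F : FreeAlg K n} {M : ℕ} (f g : NCSeries K n) :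
    trunc M (f * g) ∈ truncIdeal F M ↔ trunc M f * trunc M g ∈ truncIdeal F M := by
  have h := order_le_truncIdeal F M (trunc_mul_sub_mem_order M f g)
  exact ⟨fun h' => by simpa using sub_mem h' h, fun h' => by simpa using add_mem h h'⟩

/-- The series whose truncations lie in `truncIdeal F M`, as a two-sided ideal. -/
noncomputable def truncTwoSided (F : FreeAlg K n) (M : ℕ) : TwoSidedIdeal (NCSeries K n) :=
  TwoSidedIdeal.mk' {f | trunc M f ∈ truncIdeal F M}
    (by simp [trunc_zero])
    (fun {f g} hf hg => by simpa [trunc_add] using add_mem hf hg)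
    (fun {f} hf => by simpa [trunc_neg] using hf)
    (fun {f g} hg => (trunc_mul_mem_iff f g).2 (mul_mem_truncIdeal_left _ hg))
    (fun {f g} hf => (trunc_mul_mem_iff f g).2 (mul_mem_truncIdeal_right _ hf))

theorem mem_truncTwoSided {F : FreeAlg K n} {M : ℕ} {f : NCSeries K n} :
    f ∈ truncTwoSided F M ↔ trunc M f ∈ truncIdeal F M := by
  simp only [truncTwoSided, TwoSidedIdeal.mem_mk', Set.mem_ofPred_eq]

/-- The ideal that the relations and the series of high order generate among the formal power series
consists of the series whose truncation lies in the corresponding ideal of the free algebra. -/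
theorem mem_span_sup_highDegree {F : FreeAlg K n} {N : ℕ} {f : NCSeries K n} :
    f ∈ TwoSidedIdeal.span (Set.range fun j : Fin n => ofFreeAlg (FreeAlg.delta j F)) ⊔
      highDegree K n N ↔ trunc (N + 1) f ∈ truncIdeal F (N + 1) := by
  set I := TwoSidedIdeal.span (Set.range fun j : Fin n => ofFreeAlg (FreeAlg.delta j F)) ⊔
      highDegree K n N with hI
  have hhigh : ∀ g : NCSeries K n, (∀ w, w.length ≤ N → g.coeff w = 0) → g ∈ I := fun g hg =>
    TwoSidedIdeal.mem_sup_right (TwoSidedIdeal.subset_span hg)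
  constructor
  · intro hf
    rw [← mem_truncTwoSided]
    refine (sup_le ?_ ?_ : I ≤ truncTwoSided F (N + 1)) hf
    · refine TwoSidedIdeal.span_le.2 ?_
      rintro _ ⟨j, rfl⟩
      refine mem_truncTwoSided.2 ?_
      have := add_mem (order_le_truncIdeal F _ (trunc_ofFreeAlg_sub_mem_order (N + 1) (delta j F)))
        (delta_mem_truncIdeal F j (N + 1))
      rwa [sub_add_cancel] at this
    · refine TwoSidedIdeal.span_le.2 ?_
      intro g hg
      refine mem_truncTwoSided.2 (order_le_truncIdeal F _ (mem_order.2 fun w hw => ?_))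
      rw [coeff_trunc_of_lt _ hw]
      exact hg w (Nat.lt_succ_iff.1 hw)
  · intro hf
    have h1 : trunc (N + 1) f ∈ I.comap (ofFreeAlgHom K n) := by
      refine truncIdeal_le_twoSidedIdeal (fun w hw => ?_) (fun j => ?_) hf
      · rw [TwoSidedIdeal.mem_comap]
        refine hhigh _ fun v hv => ?_
        exact Finsupp.single_eq_of_ne (by rintro rfl; omega)
      · rw [TwoSidedIdeal.mem_comap]
        exact TwoSidedIdeal.mem_sup_left (TwoSidedIdeal.subset_span ⟨j, rfl⟩)
    rw [TwoSidedIdeal.mem_comap] at h1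
    have h2 : f - ofFreeAlgHom K n (trunc (N + 1) f) ∈ I := by
      refine hhigh _ fun w hw => ?_
      rw [coeff_sub]
      change f.coeff w - (trunc (N + 1) f).coeff w = 0
      rw [coeff_trunc_of_lt _ (Nat.lt_succ_iff.2 hw), sub_self]
    have := I.add_mem h2 h1
    rwa [sub_add_cancel] at this

theorem mem_closedRelIdeal {F : FreeAlg K n} {f : NCSeries K n} :
    f ∈ closedRelIdeal F ↔ ∀ N, trunc (N + 1) f ∈ truncIdeal F (N + 1) := by
  rw [closedRelIdeal, TwoSidedIdeal.mem_iInf]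
  simp_rw [mem_span_sup_highDegree]

theorem trunc_sub_trunc_mem_order {M N : ℕ} (h : M ≤ N) (f : NCSeries K n) :
    trunc N f - trunc M f ∈ order K n M := by
  rw [mem_order]
  intro w hw
  rw [MonoidAlgebra.coeff_sub, Finsupp.sub_apply, coeff_trunc_of_lt _ hw,
    coeff_trunc_of_lt _ (hw.trans_le h), sub_self]

end NCSeries

namespace FreeAlg

variable {K : Type*} [Field K] {n : ℕ}

theorem completedAlg_X_mul_ne_zero {F : FreeAlg K n} {j : Fin n}
    (h : ∀ M f, X K j * f ∈ truncIdeal F (M + 1) → f ∈ truncIdeal F M) (a : CompletedAlg F)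
    (ha : a ≠ 0) : CompletedAlg.X F j * a ≠ 0 := by
  obtain ⟨f, rfl⟩ := (completedIdeal F).ringCon.mk'_surjective a
  have hz : ∀ g, (completedIdeal F).ringCon.mk' g = 0 ↔ g ∈ completedIdeal F := fun g => by
    rw [← TwoSidedIdeal.mem_ker, TwoSidedIdeal.ker_ringCon_mk']
  intro h0
  rw [CompletedAlg.X, ← map_mul, hz, mem_completedIdeal] at h0
  rw [ne_eq, hz, mem_completedIdeal] at ha
  exact ha fun M => h M f (h0 (M + 1))

theorem completedSeriesAlg_X_mul_ne_zero {F : FreeAlg K n} {j : Fin n}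
    (h : ∀ M f, X K j * f ∈ truncIdeal F (M + 1) → f ∈ truncIdeal F M) (a : CompletedSeriesAlg F)
    (ha : a ≠ 0) : CompletedSeriesAlg.X F j * a ≠ 0 := by
  obtain ⟨f, rfl⟩ := (NCSeries.closedRelIdeal F).ringCon.mk'_surjective a
  have hz : ∀ g, (NCSeries.closedRelIdeal F).ringCon.mk' g = 0 ↔
      g ∈ NCSeries.closedRelIdeal F := fun g => by
    rw [← TwoSidedIdeal.mem_ker, TwoSidedIdeal.ker_ringCon_mk']
  intro h0
  rw [CompletedSeriesAlg.X, ← map_mul, hz, NCSeries.mem_closedRelIdeal] at h0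
  rw [ne_eq, hz, NCSeries.mem_closedRelIdeal] at ha
  refine ha fun N => ?_
  -- Compare `x_j f` truncated in degree `N + 2` with `x_j` times the truncation of `f`.
  have h1 := (NCSeries.trunc_mul_mem_iff _ _).1 (h0 (N + 1))
  have h2 := mul_mem_truncIdeal_right (NCSeries.trunc (N + 1 + 1) f) (order_le_truncIdeal F _
    (NCSeries.trunc_ofFreeAlg_sub_mem_order (N + 1 + 1) (X K j)))
  have h3 := sub_mem h1 h2
  rw [← sub_mul, sub_sub_cancel] at h3
  have h4 := sub_mem (h _ _ h3) (order_le_truncIdeal F _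
    (NCSeries.trunc_sub_trunc_mem_order (Nat.le_succ (N + 1)) f))
  rwa [sub_sub_cancel] at h4

end FreeAlg

/-- On a countable space every property holds generically: points are Zariski closed, and there are
only countably many of them. -/
theorem holdsGenerically_of_countable {K V : Type*} [Field K] [AddCommGroup V] [Module K V]
    [Countable V] [Nontrivial V] (P : V → Prop) : HoldsGenerically K P := by
  obtain ⟨f, hf⟩ := exists_surjective_nat V
  refine ⟨fun i => {f i}, fun i => ⟨isZariskiClosed_singleton _, fun h => ?_⟩, fun v hv => ?_⟩
  · obtain ⟨w, hw⟩ := exists_ne (f i)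
    exact hw (Set.eq_univ_iff_forall.1 h w)
  · obtain ⟨i, rfl⟩ := hf v
    exact (hv i rfl).elim

theorem lemma3p1 (K : Type*) [Field K] (n k m : ℕ) (hn : 2 ≤ n) (hk : 3 ≤ k) (hkm : k ≤ m)
    (hnk : (n, k) ≠ (2, 3)) :
    HoldsGenerically K (fun F : potentials K n k m =>
      (∀ a : CompletedAlg (F : FreeAlg K n), a ≠ 0 →
        CompletedAlg.X (F : FreeAlg K n) ⟨0, by omega⟩ * a ≠ 0) ∧
      (∀ a : CompletedSeriesAlg (F : FreeAlg K n), a ≠ 0 →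
        CompletedSeriesAlg.X (F : FreeAlg K n) ⟨0, by omega⟩ * a ≠ 0)) := by
  obtain ⟨G, hG, u, hu, hov⟩ := FreeAlg.exists_potential_hasLeadingWords K hn hk hkm hnk
    (x₀ := ⟨0, by omega⟩) rfl
  obtain ⟨d, rfl⟩ : ∃ d, k = d + 2 := ⟨k - 2, by omega⟩
  -- over a finite field no two generic conditions can be combined, but the statement is trivial
  cases finite_or_infinite K
  · have : Countable (FreeAlg K n) := MonoidAlgebra.coeff_injective.countable
    have hG0 : (⟨G, hG⟩ : potentials K n (d + 2) m) ≠ 0 := by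
      intro h
      have h1 := hu.coeff_eq_one ⟨0, by omega⟩
      have hG0 : G = 0 := congrArg Subtype.val h
      rw [hG0, map_zero] at h1
      exact zero_ne_one h1
    have : Nontrivial (potentials K n (d + 2) m) := ⟨_, _, hG0⟩
    exact holdsGenerically_of_countable _
  · choose p hp hp' using FreeAlg.exists_mvPolynomial_X_mul_mem hG hu hov
    refine ⟨fun M => {F | MvPolynomial.eval (fun φ => φ F) (p M) = 0},
      fun M => ⟨isZariskiClosed_zeros _, fun h => ?_⟩, fun F hF => ?_⟩
    · obtain ⟨F₀, hF₀⟩ := hp M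
      exact hF₀ (Set.eq_univ_iff_forall.1 h F₀)
    · have h := fun M => hp' M F (hF M)
      exact ⟨FreeAlg.completedAlg_X_mul_ne_zero h, FreeAlg.completedSeriesAlg_X_mul_ne_zero h⟩
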